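/- Let $\mathbb{K}$ be a field, $G$ an abelian group, and put $\bar G=\mathbb{Z}\times G$. For a group $\Gamma$ ($=G$ or $\bar G$) and a $\Gamma$-graded $\mathbb{K}$-algebra $B$, let $B^e=B\otimes_{\mathbb{K}}B^{o}$ be the enveloping algebra with its induced $\Gamma$-grading. Call $B$ *homologically $\Gamma$-smooth* if $B$ admits a bounded projective resolution with finitely generated terms in the category of $\Gamma$-graded left $B^e$-modules and degree-preserving linear maps. Let $A$ be a $G$-graded $\mathbb{K}$-algebra, and let $F=\{F_nA\}_{n\in\mathbb{Z}}$ be a positive homo-filtration on $A$, that is, an increasing sequence of homogeneous subspaces of $A$ such that $1\in F_0A$, $\bigcup_{n}F_nA=A$, $F_mA\cdot F_nA\subseteq F_{m+n}A$ for all $m,n\in\mathbb{Z}$, and $F_nA=0$ for $n<0$. Consider the $\bar G$-graded algebras $$R_F(A)=\bigoplus_{n\in\mathbb{Z}}F_nA\cdot t^n\subseteq A[t,t^{-1}],\qquad G_F(A)=R_F(A)/(t),$$ where $a t^n$ has degree $(n,g)$ for $a\in F_nA\cap A_g$. If $G_F(A)$ is homologically $\bar G$-smooth, then $R_F(A)$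 is homologically $\bar G$-smooth and $A$ is homologically $G$-smooth. -/

import Mathlib

open scoped TensorProduct LaurentPolynomial

universe u v w

section GradedModules

variable {G : Type v} [AddCommGroup G] [DecidableEq G]
  {K : Type w} [Field K] {A : Type u} [Ring A] [Algebra K A]

/-- A `G`-graded left module over the `K`-algebra `A` graded by the subspaces `𝒜 g`: an object of
the category `Mod^G A`. The graded pieces are automatically stable under `K`, because
`K` acts through the component of degree zero of `A`. -/
structure GradedMod (𝒜 : G → Submodule K A) where
  /-- The underlying module. -/
  carrier : Type u
  [addCommGroup : AddCommGroup carrier]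
  [module : Module A carrier]
  /-- The homogeneous component of each degree. -/
  piece : G → AddSubgroup carrier
  isInternal : DirectSum.IsInternal piece
  smul_mem : ∀ {g h : G} {a : A} {x : carrier}, a ∈ 𝒜 g → x ∈ piece h → a • x ∈ piece (g + h)

attribute [instance] GradedMod.addCommGroup GradedMod.module

/-- A morphism of `Mod^G A`: an `A`-linear map that preserves degrees. -/
structure GradedMod.Hom {𝒜 : G → Submodule K A} (M N : GradedMod 𝒜) where
  /-- The underlying linear map. -/
  toLinearMap : M.carrier →ₗ[A] N.carrier
  map_mem : ∀ (g : G) (x : M.carrier), x ∈ M.piece g → toLinearMap x ∈ N.piece g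

/-- `P` is a projective object of `Mod^G A`: morphisms out of `P` lift along epimorphisms,
that is, along surjective morphisms. -/
def GradedMod.IsProjective {𝒜 : G → Submodule K A} (P : GradedMod 𝒜) : Prop :=
  ∀ (X Y : GradedMod 𝒜) (f : X.Hom Y) (q : P.Hom Y), Function.Surjective f.toLinearMap →
    ∃ q' : P.Hom X, f.toLinearMap ∘ₗ q'.toLinearMap = q.toLinearMap

/-- `M` has a bounded projective resolution
`0 → P n → ⋯ → P 1 → P 0 → M → 0` in `Mod^G A` with each term finitely generated. -/
def GradedMod.HasBoundedFGProjectiveResolution {𝒜 : G → Submodule K A} (M : GradedMod 𝒜) : Prop :=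
  ∃ (P : ℕ → GradedMod 𝒜) (d : ∀ i, (P (i + 1)).Hom (P i)) (η : (P 0).Hom M),
    (∀ i, (P i).IsProjective) ∧
    (∀ i, Module.Finite A (P i).carrier) ∧
    (∃ n, ∀ i, n < i → Subsingleton (P i).carrier) ∧
    Function.Surjective η.toLinearMap ∧
    Function.Exact (d 0).toLinearMap η.toLinearMap ∧
    ∀ i, Function.Exact (d (i + 1)).toLinearMap (d i).toLinearMap

/-- The `G`-grading of the enveloping algebra `A ⊗ Aᵒ`: the component of degree `g` is spanned by
the `a ⊗ b` with `a`, `b` homogeneous of degrees that add up to `g`. -/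
def envelopingGrading (𝒜 : G → Submodule K A) (g : G) : Submodule K (A ⊗[K] Aᵐᵒᵖ) :=
  Submodule.span K {z | ∃ i j : G, i + j = g ∧ ∃ a ∈ 𝒜 i, ∃ b ∈ 𝒜 j,
    z = a ⊗ₜ[K] MulOpposite.op b}

/-- The graded algebra `A` as a graded bimodule over itself, i.e. as a graded module over
`A ⊗ Aᵒ`, with action `(a ⊗ b) • x = a * x * b`. -/
def GradedMod.regularBimodule (𝒜 : G → Submodule K A) [GradedAlgebra 𝒜] :
    GradedMod (envelopingGrading 𝒜) :=
  letI : Module (A ⊗[K] Aᵐᵒᵖ) A := TensorProduct.Algebra.module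
  { carrier := A
    piece := fun g => (𝒜 g).toAddSubgroup
    isInternal := DirectSum.Decomposition.isInternal 𝒜
    smul_mem := by
      intro g h z x hz hx
      have key : envelopingGrading 𝒜 g ≤ (𝒜 (g + h)).comap
          ((TensorProduct.Algebra.moduleAux (R := K) (A := A) (B := Aᵐᵒᵖ) (M := A)).flip x) := by
        refine Submodule.span_le.2 ?_
        rintro _ ⟨i, j, rfl, a, ha, b, hb, rfl⟩
        have h1 : a * (x * b) ∈ 𝒜 (i + (h + j)) :=
          SetLike.mul_mem_graded ha (SetLike.mul_mem_graded hx hb)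
        rw [show i + (h + j) = i + j + h by abel] at h1
        exact h1
      exact key hz }

/-- The `G`-graded algebra `A` is homologically `G`-smooth. -/
def HomologicallySmooth (𝒜 : G → Submodule K A) [GradedAlgebra 𝒜] : Prop :=
  (GradedMod.regularBimodule 𝒜).HasBoundedFGProjectiveResolution

end GradedModules

section InternalCriterion

theorem isInternal_of_proj {ι : Type*} [DecidableEq ι] {K M : Type*} [Field K] [AddCommGroup M]
    [Module K M] (ℳ : ι → Submodule K M) (π : ι → M →ₗ[K] M)
    (h1 : ∀ i, ∀ x ∈ ℳ i, π i x = x) (h2 : ∀ i j, i ≠ j → ∀ x ∈ ℳ i, π j x = 0)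
    (h3 : ∀ x, x ∈ iSup ℳ) : DirectSum.IsInternal ℳ := by
  rw [DirectSum.isInternal_submodule_iff_iSupIndep_and_iSup_eq_top]
  refine ⟨?_, eq_top_iff.2 fun x _ => h3 x⟩
  rw [iSupIndep_def]
  intro i
  rw [Submodule.disjoint_def]
  intro x hx hx'
  have h4 : (⨆ j, ⨆ (_ : j ≠ i), ℳ j) ≤ LinearMap.ker (π i) :=
    iSup₂_le fun j hj y hy => h2 j i hj y hy
  rw [← h1 i x hx]
  exact h4 hx'

end InternalCriterion

section HomoFiltrations

variable {G : Type v} [AddCommGroup G] [DecidableEq G]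
  {K : Type w} [Field K] {A : Type u} [Ring A] [Algebra K A]

/-- A homo-filtration on the `G`-graded algebra `A`: an increasing exhaustive multiplicative
filtration by homogeneous subspaces indexed by the integers. -/
structure HomoFiltration (𝒜 : G → Submodule K A) [GradedAlgebra 𝒜] where
  /-- The layers of the filtration. -/
  F : ℤ → Submodule K A
  mono : Monotone F
  isHomogeneous : ∀ (n : ℤ) (g : G) (a : A), a ∈ F n → (DirectSum.decompose 𝒜 a g : A) ∈ F n
  one_mem : (1 : A) ∈ F 0
  iUnion_eq : ⋃ n, (F n : Set A) = Set.univ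
  mul_mem : ∀ (m n : ℤ) (a b : A), a ∈ F m → b ∈ F n → a * b ∈ F (m + n)

namespace HomoFiltration

variable {𝒜 : G → Submodule K A} [GradedAlgebra 𝒜] (F : HomoFiltration 𝒜)

/-- The homo-filtration is positive if its layers of negative index vanish. -/
def IsPositive : Prop := ∀ n < 0, F.F n = ⊥

/-- The Rees algebra: the subalgebra of `A[t, t⁻¹]` of the Laurent polynomials whose coefficient of
`t ^ n` lies in the `n`-th layer, for all `n`. -/
noncomputable def rees : Subalgebra K A[T;T⁻¹] where
  carrier := {p | ∀ n, p.coeff n ∈ F.F n}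
  mul_mem' := by
    intro p q hp hq n
    classical
    rw [AddMonoidAlgebra.coeff_mul]
    refine Submodule.sum_mem _ fun i _ => Submodule.sum_mem _ fun j _ => ?_
    dsimp only
    split_ifs with h
    · exact h ▸ F.mul_mem i j _ _ (hp i) (hq j)
    · exact zero_mem _
  add_mem' := fun hp hq n => add_mem (hp n) (hq n)
  algebraMap_mem' := by
    intro k n
    rw [Algebra.algebraMap_eq_smul_one]
    refine Submodule.smul_mem _ k ?_
    change (1 : A[T;T⁻¹]).coeff n ∈ F.F n
    rw [AddMonoidAlgebra.one_def, AddMonoidAlgebra.coeff_single, Finsupp.single_apply]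
    split_ifs with h
    · exact h ▸ F.one_mem
    · exact zero_mem _

/-- The element `a * t ^ n` of the Rees algebra, for `a` in the `n`-th layer. -/
noncomputable def reesMonomial (n : ℤ) : F.F n →ₗ[K] F.rees where
  toFun a := ⟨AddMonoidAlgebra.single n (a : A), by
    intro m
    rw [AddMonoidAlgebra.coeff_single, Finsupp.single_apply]
    split_ifs with h
    · exact h ▸ a.2
    · exact zero_mem _⟩
  map_add' a b := Subtype.ext (AddMonoidAlgebra.single_add n (a : A) b)
  map_smul' k a := Subtype.ext (AddMonoidAlgebra.smul_single k n (a : A)).symm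

/-- The element `t` of the Rees algebra. -/
noncomputable def reesT : F.rees := F.reesMonomial 1 ⟨1, F.mono zero_le_one F.one_mem⟩

/-- The grading of the Rees algebra by `ℤ × G`: the component of degree `(n, g)` consists of the
`a * t ^ n` with `a` in the `n`-th layer and homogeneous of degree `g`. -/
noncomputable def reesGrading (i : ℤ × G) : Submodule K F.rees :=
  ((𝒜 i.2).comap (F.F i.1).subtype).map (F.reesMonomial i.1)

theorem mem_reesGrading {i : ℤ × G} {p : F.rees} :
    p ∈ F.reesGrading i ↔
      ∃ a ∈ F.F i.1, a ∈ 𝒜 i.2 ∧ (p : A[T;T⁻¹]) = AddMonoidAlgebra.single i.1 a := by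
  constructor
  · rintro ⟨a, ha, rfl⟩
    exact ⟨a, a.2, ha, rfl⟩
  · rintro ⟨a, ha, ha', h⟩
    exact ⟨⟨a, ha⟩, ha', Subtype.ext h.symm⟩

/-- The projection of the Rees algebra onto its component of degree `(n, g)`. -/
noncomputable def reesProj (i : ℤ × G) : F.rees →ₗ[K] F.rees where
  toFun p := F.reesMonomial i.1
    ⟨GradedAlgebra.proj 𝒜 i.2 ((p : A[T;T⁻¹]).coeff i.1), F.isHomogeneous i.1 i.2 _ (p.2 i.1)⟩
  map_add' p q := by
    rw [← map_add]
    exact congrArg _ (Subtype.ext (map_add (GradedAlgebra.proj 𝒜 i.2) _ _))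
  map_smul' k p := by
    rw [RingHom.id_apply, ← map_smul]
    exact congrArg _ (Subtype.ext (map_smul (GradedAlgebra.proj 𝒜 i.2) k _))

theorem reesProj_self (i : ℤ × G) (p : F.rees) (hp : p ∈ F.reesGrading i) :
    F.reesProj i p = p := by
  obtain ⟨a, _, ha', h⟩ := F.mem_reesGrading.1 hp
  refine Subtype.ext ?_
  change AddMonoidAlgebra.single i.1 (GradedAlgebra.proj 𝒜 i.2 ((p : A[T;T⁻¹]).coeff i.1)) = _
  rw [h, AddMonoidAlgebra.coeff_single, Finsupp.single_apply, if_pos rfl, GradedAlgebra.proj_apply,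
    DirectSum.decompose_of_mem_same 𝒜 ha']

theorem reesProj_of_ne (i j : ℤ × G) (hij : i ≠ j) (p : F.rees) (hp : p ∈ F.reesGrading i) :
    F.reesProj j p = 0 := by
  obtain ⟨a, _, ha', h⟩ := F.mem_reesGrading.1 hp
  refine Subtype.ext ?_
  change AddMonoidAlgebra.single j.1 (GradedAlgebra.proj 𝒜 j.2 ((p : A[T;T⁻¹]).coeff j.1)) = 0
  rw [h, AddMonoidAlgebra.coeff_single, Finsupp.single_apply, GradedAlgebra.proj_apply]
  split_ifs with h1
  · have h2 : i.2 ≠ j.2 := fun h2 => hij (Prod.ext h1 h2)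
    rw [DirectSum.decompose_of_mem_ne 𝒜 ha' h2, AddMonoidAlgebra.single_zero]
  · simp

theorem mem_iSup_reesGrading (p : F.rees) : p ∈ iSup F.reesGrading := by
  classical
  have h1 : ∀ n (a : F.F n), F.reesMonomial n a ∈ iSup F.reesGrading := by
    intro n a
    have h2 : a = ∑ g ∈ (DirectSum.decompose 𝒜 (a : A)).support,
        (⟨DirectSum.decompose 𝒜 (a : A) g, F.isHomogeneous n g _ a.2⟩ : F.F n) := by
      refine Subtype.ext ?_
      rw [AddSubmonoidClass.coe_finsetSum]
      exact (DirectSum.sum_support_decompose 𝒜 (a : A)).symm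
    rw [h2, map_sum]
    refine Submodule.sum_mem _ fun g _ => ?_
    refine Submodule.mem_iSup_of_mem (n, g) ?_
    exact ⟨⟨DirectSum.decompose 𝒜 (a : A) g, F.isHomogeneous n g _ a.2⟩,
      (DirectSum.decompose 𝒜 (a : A) g).2, rfl⟩
  have h3 : p = ∑ n ∈ (p : A[T;T⁻¹]).coeff.support,
      F.reesMonomial n ⟨(p : A[T;T⁻¹]).coeff n, p.2 n⟩ := by
    refine Subtype.ext ?_
    rw [AddSubmonoidClass.coe_finsetSum]
    exact (AddMonoidAlgebra.sum_coeff_single (p : A[T;T⁻¹])).symm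
  rw [h3]
  exact Submodule.sum_mem _ fun n _ => h1 n _

theorem rees_gradedMonoid : SetLike.GradedMonoid F.reesGrading where
  one_mem := F.mem_reesGrading.2 ⟨1, F.one_mem, SetLike.one_mem_graded 𝒜, rfl⟩
  mul_mem := by
    intro i j p q hp hq
    obtain ⟨a, ha, ha', h⟩ := F.mem_reesGrading.1 hp
    obtain ⟨b, hb, hb', h'⟩ := F.mem_reesGrading.1 hq
    refine F.mem_reesGrading.2 ⟨a * b, F.mul_mem _ _ _ _ ha hb, SetLike.mul_mem_graded ha' hb', ?_⟩
    rw [MulMemClass.coe_mul, h, h', AddMonoidAlgebra.single_mul_single]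
    rfl

noncomputable instance : GradedAlgebra F.reesGrading :=
  letI := F.rees_gradedMonoid
  letI := (isInternal_of_proj F.reesGrading F.reesProj F.reesProj_self F.reesProj_of_ne
    F.mem_iSup_reesGrading).chooseDecomposition
  { }

theorem reesT_coe : (F.reesT : A[T;T⁻¹]) = LaurentPolynomial.T 1 := rfl

theorem reesT_mul_comm (p : F.rees) : F.reesT * p = p * F.reesT :=
  Subtype.ext (LaurentPolynomial.T_mul 1 (p : A[T;T⁻¹]))

/-- The ideal of the Rees algebra that is generated by the central element `t`. -/
noncomputable def reesIdeal : Ideal F.rees := Ideal.span {F.reesT}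

instance : F.reesIdeal.IsTwoSided where
  mul_mem_of_left := by
    intro a b ha
    obtain ⟨c, rfl⟩ := Ideal.mem_span_singleton'.1 ha
    refine Ideal.mem_span_singleton'.2 ⟨c * b, ?_⟩
    rw [mul_assoc, mul_assoc, F.reesT_mul_comm]

/-- The associated graded algebra: the quotient of the Rees algebra by the ideal generated
by `t`. -/
abbrev assocGraded : Type u := F.rees ⧸ F.reesIdeal

/-- The quotient map from the Rees algebra to the associated graded algebra. -/
noncomputable def assocGradedMk : F.rees →ₐ[K] F.assocGraded := Ideal.Quotient.mkₐ K F.reesIdeal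

/-- The grading of the associated graded algebra by `ℤ × G`, induced by that of the
Rees algebra. -/
noncomputable def assocGrading (i : ℤ × G) : Submodule K F.assocGraded :=
  (F.reesGrading i).map F.assocGradedMk.toLinearMap

theorem reesProj_mul_reesT (n : ℤ) (g : G) (p : F.rees) :
    F.reesProj (n, g) (p * F.reesT) = F.reesProj (n - 1, g) p * F.reesT := by
  refine Subtype.ext ?_
  change AddMonoidAlgebra.single n (GradedAlgebra.proj 𝒜 g
      (((p : A[T;T⁻¹]) * AddMonoidAlgebra.single 1 1).coeff n)) =
    AddMonoidAlgebra.single (n - 1) (GradedAlgebra.proj 𝒜 g ((p : A[T;T⁻¹]).coeff (n - 1))) *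
      AddMonoidAlgebra.single 1 1
  rw [AddMonoidAlgebra.single_mul_single, mul_one, sub_add_cancel,
    AddMonoidAlgebra.coeff_mul_single_eq_coeff_mul (m₂ := n - 1), mul_one]
  intro m _
  omega

/-- The projection of the associated graded algebra onto its component of degree `(n, g)`. -/
noncomputable def assocProj (i : ℤ × G) : F.assocGraded →ₗ[K] F.assocGraded :=
  (F.reesIdeal.restrictScalars K).liftQ (F.assocGradedMk.toLinearMap ∘ₗ F.reesProj i) (by
    intro p hp
    obtain ⟨c, rfl⟩ := Ideal.mem_span_singleton'.1 hp
    rw [LinearMap.mem_ker, LinearMap.comp_apply, F.reesProj_mul_reesT i.1 i.2]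
    exact Ideal.Quotient.eq_zero_iff_mem.2 (Ideal.mem_span_singleton'.2 ⟨_, rfl⟩))

theorem assocProj_mk (i : ℤ × G) (p : F.rees) :
    F.assocProj i (F.assocGradedMk p) = F.assocGradedMk (F.reesProj i p) := rfl

theorem assoc_gradedMonoid : SetLike.GradedMonoid F.assocGrading where
  one_mem := ⟨1, F.rees_gradedMonoid.one_mem, map_one F.assocGradedMk⟩
  mul_mem := by
    rintro i j _ _ ⟨p, hp, rfl⟩ ⟨q, hq, rfl⟩
    exact ⟨p * q, F.rees_gradedMonoid.mul_mem hp hq, map_mul F.assocGradedMk p q⟩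

noncomputable instance : GradedAlgebra F.assocGrading :=
  letI := F.assoc_gradedMonoid
  letI := (isInternal_of_proj F.assocGrading F.assocProj
    (by
      rintro i _ ⟨p, hp, rfl⟩
      exact (F.assocProj_mk i p).trans (congrArg _ (F.reesProj_self i p hp)))
    (by
      rintro i j hij _ ⟨p, hp, rfl⟩
      refine (F.assocProj_mk j p).trans ?_
      rw [F.reesProj_of_ne i j hij p hp, map_zero])
    (by
      intro x
      obtain ⟨p, rfl⟩ := Ideal.Quotient.mk_surjective x
      have h : iSup F.assocGrading = (iSup F.reesGrading).map F.assocGradedMk.toLinearMap :=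
        (Submodule.map_iSup _ _).symm
      rw [h]
      exact ⟨p, F.mem_iSup_reesGrading p, rfl⟩)).chooseDecomposition
  { }

end HomoFiltration

end HomoFiltrations

/-! ### Internal gradings of abelian groups and their projections. -/

section InternalGradings

variable {ι : Type*} [DecidableEq ι] {M : Type*} [AddCommGroup M]

/-! Write R for the Rees algebra and t for its central regular element of degree (1, 0). The
associated graded algebra is R/(t), and A is R/(t - 1). The bridge between the enveloping algebras
is Λ = R^e/(t ⊗ 1 - 1 ⊗ t), the enveloping algebra of R relative to K[t]: killing t in Λ gives the
enveloping algebra of R/(t), killing t - 1 gives that of A. Since t is central, R is a Λ-module, and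
both t and t - 1 act injectively on it. It therefore suffices to find a finite resolution of R over
Λ and to move it up to R^e and down to A^e.

Over Λ (`hasFiniteResolution_relBimodule`): the given resolution over Λ/(t) is lifted step by step.
As Λ vanishes in negative degrees and t has positive degree, a degree-preserving matrix that is zero
modulo t is nilpotent, so idempotents, and with them finitely generated projectives, lift
(`exists_projective_lift`). The graded Nakayama lemma `surjective_of_isBoundedBelow` keeps the
lifted covers surjective, and regularity of t makes kernels reduce to kernels; the induction is
`hasFiniteResolution_of_reduction`.

Up to R^e (`exists_hasFiniteResolution_restrict`): t ⊗ 1 - 1 ⊗ t is regular by `tDiff_regular`, so a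
finitely generated projective P over Λ lifts to Q over R^e with a short exact sequence 0 → Q → Q → P
→ 0, up to a shift. Modules with finite resolutions over Λ thus have finite resolutions over R^e.

Down to A^e (`Reduction.hasFiniteResolution`): reduction modulo t - 1 preserves exactness on modules
where t - 1 acts injectively. This element is not homogeneous for ℤ × G, so the grading is first
coarsened to G.

All of this is done with `HasFiniteResolution`, which is recursive in the length and asks its terms
to be projective as ungraded modules, a property blind to coarsening. For finitely generated terms
it agrees with graded projectivity, by `isProjective_of_projective` and `IsProjective.projective`.
-/

theorem isInternal_of_addProj (p : ι → AddSubgroup M) (π : ι → M →+ M)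
    (h1 : ∀ i, ∀ x ∈ p i, π i x = x) (h2 : ∀ i j, i ≠ j → ∀ x ∈ p i, π j x = 0)
    (h3 : ∀ x, x ∈ iSup p) : DirectSum.IsInternal p := by
  have key : ∀ j (z : DirectSum ι fun i => p i), π j (DirectSum.coeAddMonoidHom p z) = z j := by
    intro j z
    induction z using DirectSum.induction_on with
    | zero => simp
    | of i x =>
      rw [DirectSum.coeAddMonoidHom_of]
      by_cases h : i = j
      · subst h
        rw [h1 i x x.2, DirectSum.of_eq_same]
      · rw [h2 i j h x x.2, DirectSum.of_eq_of_ne _ _ _ (Ne.symm h)]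
        rfl
    | add x y hx hy => rw [map_add, map_add, hx, hy]; rfl
  constructor
  · rw [injective_iff_map_eq_zero]
    intro z hz
    ext j
    rw [← key, hz, map_zero]
    rfl
  · intro x
    have h4 : iSup p ≤ (DirectSum.coeAddMonoidHom p).range :=
      iSup_le fun i y hy => ⟨DirectSum.of (fun i => p i) i ⟨y, hy⟩,
        DirectSum.coeAddMonoidHom_of _ _ _⟩
    exact h4 (h3 x)

/-- The additive map out of an internally graded group with prescribed restrictions to the
graded pieces. -/
noncomputable def DirectSum.IsInternal.liftAddHom {p : ι → AddSubgroup M}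
    (h : DirectSum.IsInternal p) {N : Type*} [AddCommGroup N] (f : ∀ i, p i →+ N) : M →+ N :=
  (DirectSum.toAddMonoid f).comp
    (AddEquiv.ofBijective (DirectSum.coeAddMonoidHom p) h).symm.toAddMonoidHom

theorem DirectSum.IsInternal.liftAddHom_apply {p : ι → AddSubgroup M}
    (h : DirectSum.IsInternal p) {N : Type*} [AddCommGroup N] (f : ∀ i, p i →+ N) {i : ι} {x : M}
    (hx : x ∈ p i) : h.liftAddHom f x = f i ⟨x, hx⟩ := by
  have h1 : (AddEquiv.ofBijective (DirectSum.coeAddMonoidHom p) h).symm x =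
      DirectSum.of (fun i => p i) i ⟨x, hx⟩ := by
    rw [AddEquiv.symm_apply_eq]
    exact (DirectSum.coeAddMonoidHom_of p i ⟨x, hx⟩).symm
  change DirectSum.toAddMonoid f ((AddEquiv.ofBijective (DirectSum.coeAddMonoidHom p) h).symm x) = _
  rw [h1, DirectSum.toAddMonoid_of]

/-- The projection of an internally graded group onto a graded piece. -/
noncomputable def DirectSum.IsInternal.proj {p : ι → AddSubgroup M}
    (h : DirectSum.IsInternal p) (j : ι) : M →+ M :=
  h.liftAddHom fun i => if i = j then (p i).subtype else 0

theorem DirectSum.IsInternal.iSup_eq {p : ι → AddSubgroup M} (h : DirectSum.IsInternal p) :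
    iSup p = ⊤ := by
  rw [eq_top_iff]
  intro x _
  obtain ⟨z, rfl⟩ := h.2 x
  induction z using DirectSum.induction_on with
  | zero => rw [map_zero]; exact zero_mem _
  | of i x =>
    rw [DirectSum.coeAddMonoidHom_of]
    exact (le_iSup p i) x.2
  | add x y hx hy => rw [map_add]; exact add_mem (hx trivial) (hy trivial)

theorem DirectSum.IsInternal.induction {p : ι → AddSubgroup M} (h : DirectSum.IsInternal p)
    {C : M → Prop} (h0 : C 0) (hadd : ∀ x y, C x → C y → C (x + y))
    (hp : ∀ i, ∀ x ∈ p i, C x) (x : M) : C x := by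
  have hx : x ∈ iSup p := by rw [h.iSup_eq]; trivial
  exact AddSubgroup.iSup_induction p (C := C) hx hp h0 hadd

section

variable {p : ι → AddSubgroup M} (h : DirectSum.IsInternal p)
include h

theorem DirectSum.IsInternal.proj_self {i : ι} {x : M} (hx : x ∈ p i) : h.proj i x = x := by
  rw [proj, h.liftAddHom_apply _ hx, if_pos rfl]
  rfl

theorem DirectSum.IsInternal.proj_of_ne {i j : ι} (hij : i ≠ j) {x : M} (hx : x ∈ p i) :
    h.proj j x = 0 := by
  rw [proj, h.liftAddHom_apply _ hx, if_neg hij]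
  rfl

theorem DirectSum.IsInternal.proj_mem (i : ι) (x : M) : h.proj i x ∈ p i := by
  induction x using h.induction with
  | h0 => rw [map_zero]; exact zero_mem _
  | hadd x y hx hy => rw [map_add]; exact add_mem hx hy
  | hp j x hx =>
    by_cases hij : j = i
    · subst hij; rwa [h.proj_self hx]
    · rw [h.proj_of_ne hij hx]; exact zero_mem _

theorem DirectSum.IsInternal.exists_sum_proj (x : M) :
    ∃ s : Finset ι, (∀ i ∉ s, h.proj i x = 0) ∧ x = ∑ i ∈ s, h.proj i x := by
  induction x using h.induction with
  | h0 => exact ⟨∅, by simp, by simp⟩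
  | hadd x y hx hy =>
    obtain ⟨s, hs, hs'⟩ := hx
    obtain ⟨t, ht, ht'⟩ := hy
    refine ⟨s ∪ t, fun i hi => ?_, ?_⟩
    · rw [Finset.mem_union, not_or] at hi
      rw [map_add, hs i hi.1, ht i hi.2, add_zero]
    · simp only [map_add]
      rw [Finset.sum_add_distrib, ← Finset.sum_subset Finset.subset_union_left
        (fun i _ hi => hs i hi), ← Finset.sum_subset Finset.subset_union_right
        (fun i _ hi => ht i hi), ← hs', ← ht']
  | hp j x hx =>
    refine ⟨{j}, fun i hi => h.proj_of_ne (fun e => hi (by simp [e])) hx, ?_⟩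
    rw [Finset.sum_singleton, h.proj_self hx]

theorem DirectSum.IsInternal.eq_zero_of_proj {x : M} (hx : ∀ i, h.proj i x = 0) : x = 0 := by
  obtain ⟨s, -, hs⟩ := h.exists_sum_proj x
  rw [hs]
  exact Finset.sum_eq_zero fun i _ => hx i

theorem DirectSum.IsInternal.mem_iff_proj_eq {i : ι} {x : M} : x ∈ p i ↔ h.proj i x = x :=
  ⟨h.proj_self, fun e => e ▸ h.proj_mem i x⟩

/-- The image of an internal grading under a surjective map with homogeneous kernel. -/
theorem DirectSum.IsInternal.map_of_surjective {N : Type*} [AddCommGroup N] (f : M →+ N)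
    (hf : Function.Surjective f) (hk : ∀ x, f x = 0 → ∀ i, f (h.proj i x) = 0) :
    DirectSum.IsInternal fun i => (p i).map f := by
  refine isInternal_of_addProj _
    (fun i => (QuotientAddGroup.lift f.ker (f.comp (h.proj i)) fun x hx => hk x hx i).comp
      (QuotientAddGroup.quotientKerEquivOfSurjective f hf).symm.toAddMonoidHom) ?_ ?_ ?_
  all_goals
    have key : ∀ i x, (QuotientAddGroup.lift f.ker (f.comp (h.proj i)) fun x hx => hk x hx i)
        ((QuotientAddGroup.quotientKerEquivOfSurjective f hf).symm (f x)) = f (h.proj i x) := by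
      intro i x
      have h1 : (QuotientAddGroup.quotientKerEquivOfSurjective f hf).symm (f x) =
          QuotientAddGroup.mk x := by
        rw [AddEquiv.symm_apply_eq]
        rfl
      rw [h1]
      rfl
  · rintro i _ ⟨x, hx, rfl⟩
    exact (key i x).trans (by rw [h.proj_self hx])
  · rintro i j hij _ ⟨x, hx, rfl⟩
    exact (key j x).trans (by rw [h.proj_of_ne hij hx, map_zero])
  · intro y
    obtain ⟨x, rfl⟩ := hf y
    obtain ⟨s, -, hs⟩ := h.exists_sum_proj x
    rw [hs, map_sum]
    exact sum_mem fun i _ => (le_iSup (fun i => (p i).map f) i) ⟨_, h.proj_mem i x, rfl⟩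

end

end InternalGradings

/-! ### Graded modules: kernels, sums, shifts and finite resolutions. -/

namespace GradedMod

variable {G : Type v} [AddCommGroup G] [DecidableEq G]
  {K : Type w} [Field K] {A : Type u} [Ring A] [Algebra K A] {𝒜 : G → Submodule K A}

/-- The projection of a graded module onto its component of degree `g`. -/
noncomputable def proj (M : GradedMod 𝒜) (g : G) : M.carrier →+ M.carrier := M.isInternal.proj g

theorem proj_smul (M : GradedMod 𝒜) {k : G} {a : A} (ha : a ∈ 𝒜 k) (g : G) (x : M.carrier) :
    M.proj (k + g) (a • x) = a • M.proj g x := by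
  unfold proj
  induction x using M.isInternal.induction with
  | h0 => simp
  | hadd x y hx hy => rw [smul_add, map_add, map_add, hx, hy, smul_add]
  | hp j x hx =>
    by_cases hij : j = g
    · subst hij
      rw [M.isInternal.proj_self hx, M.isInternal.proj_self (M.smul_mem ha hx)]
    · rw [M.isInternal.proj_of_ne hij hx, M.isInternal.proj_of_ne _ (M.smul_mem ha hx), smul_zero]
      exact fun e => hij (add_left_cancel e)

theorem Hom.map_proj {M N : GradedMod 𝒜} (f : M.Hom N) (g : G) (x : M.carrier) :
    f.toLinearMap (M.proj g x) = N.proj g (f.toLinearMap x) := by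
  unfold proj
  induction x using M.isInternal.induction with
  | h0 => simp
  | hadd x y hx hy => rw [map_add, map_add, hx, hy, map_add, map_add]
  | hp j x hx =>
    by_cases hij : j = g
    · subst hij
      rw [M.isInternal.proj_self hx, N.isInternal.proj_self (f.map_mem _ _ hx)]
    · rw [M.isInternal.proj_of_ne hij hx, N.isInternal.proj_of_ne hij (f.map_mem _ _ hx), map_zero]

/-- Morphisms commute with the projections, so an injective one also detects that `x` equals its own
component of degree `g`. -/
theorem Hom.mem_of_map_mem {M N : GradedMod 𝒜} (f : M.Hom N)
    (hf : Function.Injective f.toLinearMap) {g : G} {x : M.carrier}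
    (hx : f.toLinearMap x ∈ N.piece g) : x ∈ M.piece g := by
  rw [M.isInternal.mem_iff_proj_eq]
  apply hf
  exact (f.map_proj g x).trans (N.isInternal.proj_self hx)

theorem Hom.exists_homogeneous_preimage {M N : GradedMod 𝒜} (f : M.Hom N)
    (hf : Function.Surjective f.toLinearMap) {g : G} {y : N.carrier} (hy : y ∈ N.piece g) :
    ∃ x ∈ M.piece g, f.toLinearMap x = y := by
  obtain ⟨x, rfl⟩ := hf y
  exact ⟨M.proj g x, M.isInternal.proj_mem g x,
    (f.map_proj g x).trans (N.isInternal.proj_self hy)⟩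

/-- The composition of morphisms of graded modules. -/
def Hom.comp {M N P : GradedMod 𝒜} (f : N.Hom P) (g : M.Hom N) : M.Hom P where
  toLinearMap := f.toLinearMap ∘ₗ g.toLinearMap
  map_mem i x hx := f.map_mem i _ (g.map_mem i x hx)

/-- Morphisms with values in the image of an injective morphism factor through it. -/
theorem Hom.exists_factor {M N P : GradedMod 𝒜} (i : N.Hom P)
    (hi : Function.Injective i.toLinearMap) (f : M.Hom P)
    (hf : ∀ x, ∃ y, i.toLinearMap y = f.toLinearMap x) :
    ∃ h : M.Hom N, ∀ x, i.toLinearMap (h.toLinearMap x) = f.toLinearMap x := by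
  let e := LinearEquiv.ofInjective i.toLinearMap hi
  let h : M.carrier →ₗ[A] N.carrier :=
    e.symm.toLinearMap ∘ₗ f.toLinearMap.codRestrict (LinearMap.range i.toLinearMap) hf
  have key : ∀ x, i.toLinearMap (h x) = f.toLinearMap x := by
    intro x
    have h1 : e (h x) = f.toLinearMap.codRestrict (LinearMap.range i.toLinearMap) hf x :=
      LinearEquiv.apply_symm_apply _ _
    exact congrArg Subtype.val h1
  refine ⟨⟨h, fun g x hx => i.mem_of_map_mem hi ?_⟩, key⟩
  rw [key]
  exact f.map_mem g x hx

/-- A graded module that is projective as a module is projective in the category of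
graded modules. -/
theorem isProjective_of_projective (h𝒜 : iSup 𝒜 = ⊤) (P : GradedMod 𝒜)
    [Module.Projective A P.carrier] : P.IsProjective := by
  intro X Y f q hf
  obtain ⟨h, hh⟩ := Module.projective_lifting_property f.toLinearMap q.toLinearMap hf
  have hh' : ∀ x, f.toLinearMap (h x) = q.toLinearMap x := fun x => LinearMap.congr_fun hh x
  -- The lift `h` need not preserve degrees; `k` is its degree-preserving part, which sends `x` of
  -- degree `g` to the component of `h x` of degree `g`.
  let k : P.carrier →+ X.carrier := P.isInternal.liftAddHom fun g =>
    (X.proj g).comp (h.toAddMonoidHom.comp (P.piece g).subtype)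
  have hk : ∀ g x, x ∈ P.piece g → k x = X.proj g (h x) := fun g x hx =>
    P.isInternal.liftAddHom_apply _ hx
  have hsmul : ∀ (a : A) (x : P.carrier), k (a • x) = a • k x := by
    intro a x
    have ha : a ∈ iSup 𝒜 := by rw [h𝒜]; trivial
    induction x using P.isInternal.induction with
    | h0 => simp
    | hadd x y hx hy => rw [smul_add, map_add, map_add, hx, hy, smul_add]
    | hp j x hx =>
      induction ha using Submodule.iSup_induction' with
      | zero => simp
      | add a b _ _ h1 h2 => rw [add_smul, map_add, h1, h2, add_smul]
      | mem g a ha =>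
        rw [hk _ _ (P.smul_mem ha hx), hk _ _ hx, map_smul, X.proj_smul ha]
  refine ⟨⟨{ toFun := k, map_add' := map_add k, map_smul' := hsmul }, fun g x hx => ?_⟩, ?_⟩
  · change k x ∈ _
    rw [hk g x hx]
    exact X.isInternal.proj_mem g _
  · ext x
    change f.toLinearMap (k x) = _
    induction x using P.isInternal.induction with
    | h0 => simp
    | hadd x y hx hy => rw [map_add, map_add, hx, hy, map_add]
    | hp j x hx =>
      rw [hk j x hx, f.map_proj, hh']
      exact Y.isInternal.proj_self (q.map_mem _ _ hx)

/-- The kernel of a morphism of graded modules. -/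
def ker {M N : GradedMod 𝒜} (f : M.Hom N) : GradedMod 𝒜 where
  carrier := LinearMap.ker f.toLinearMap
  piece g := (M.piece g).comap (LinearMap.ker f.toLinearMap).subtype.toAddMonoidHom
  isInternal := by
    have hmem : ∀ g (x : LinearMap.ker f.toLinearMap),
        M.proj g x ∈ LinearMap.ker f.toLinearMap := by
      intro g x
      rw [LinearMap.mem_ker, f.map_proj, x.2, map_zero]
    refine isInternal_of_addProj _ (fun g =>
      { toFun := fun x => ⟨M.proj g x, hmem g x⟩
        map_zero' := Subtype.ext (map_zero (M.proj g))
        map_add' := fun x y => Subtype.ext (map_add (M.proj g) _ _) }) ?_ ?_ ?_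
    · exact fun g x hx => Subtype.ext (M.isInternal.proj_self hx)
    · exact fun g k hgk x hx => Subtype.ext (M.isInternal.proj_of_ne hgk hx)
    · intro x
      obtain ⟨s, -, hs⟩ := M.isInternal.exists_sum_proj x
      have h1 : x = ∑ g ∈ s, (⟨M.proj g x, hmem g x⟩ : LinearMap.ker f.toLinearMap) := by
        refine Subtype.ext ?_
        rw [AddSubmonoidClass.coe_finsetSum]
        exact hs
      rw [h1]
      exact sum_mem fun g _ => AddSubgroup.mem_iSup_of_mem g (M.isInternal.proj_mem g x)
  smul_mem ha hx := M.smul_mem ha hx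

/-- The inclusion of the kernel of a morphism. -/
def kerι {M N : GradedMod 𝒜} (f : M.Hom N) : (ker f).Hom M where
  toLinearMap := (LinearMap.ker f.toLinearMap).subtype
  map_mem _ _ hx := hx

theorem kerι_injective {M N : GradedMod 𝒜} (f : M.Hom N) :
    Function.Injective (kerι f).toLinearMap := Subtype.val_injective

theorem exact_kerι {M N : GradedMod 𝒜} (f : M.Hom N) :
    Function.Exact (kerι f).toLinearMap f.toLinearMap := fun x =>
  ⟨fun hx => ⟨⟨x, hx⟩, rfl⟩, by rintro ⟨y, rfl⟩; exact y.2⟩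

/-- A zero graded module. -/
def zero (𝒜 : G → Submodule K A) : GradedMod 𝒜 where
  carrier := PUnit
  piece _ := ⊥
  isInternal := isInternal_of_addProj _ (fun _ => 0) (fun _ _ _ => Subsingleton.elim _ _)
    (fun _ _ _ _ _ => rfl) (fun x => Subsingleton.elim 0 x ▸ zero_mem _)
  smul_mem _ _ := Subsingleton.elim _ _

/-- The zero morphism. -/
def zeroHom (M N : GradedMod 𝒜) : M.Hom N where
  toLinearMap := 0
  map_mem _ _ _ := zero_mem _

/-- The identity morphism. -/
def Hom.id (M : GradedMod 𝒜) : M.Hom M where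
  toLinearMap := LinearMap.id
  map_mem _ _ hx := hx

/-- The direct sum of two graded modules. -/
def prod (M N : GradedMod 𝒜) : GradedMod 𝒜 where
  carrier := M.carrier × N.carrier
  piece g := (M.piece g).prod (N.piece g)
  isInternal := by
    refine isInternal_of_addProj _ (fun g => (M.proj g).prodMap (N.proj g)) ?_ ?_ ?_
    · exact fun g x hx => Prod.ext (M.isInternal.proj_self hx.1) (N.isInternal.proj_self hx.2)
    · exact fun g k hgk x hx =>
        Prod.ext (M.isInternal.proj_of_ne hgk hx.1) (N.isInternal.proj_of_ne hgk hx.2)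
    · rintro ⟨x, y⟩
      have h1 : ∀ x : M.carrier, ((x, 0) : M.carrier × N.carrier) ∈
          iSup fun g => (M.piece g).prod (N.piece g) := by
        intro x
        induction x using M.isInternal.induction with
        | h0 => exact zero_mem _
        | hadd x y hx hy => simpa using add_mem hx hy
        | hp g x hx => exact AddSubgroup.mem_iSup_of_mem g ⟨hx, zero_mem _⟩
      have h2 : ∀ y : N.carrier, ((0, y) : M.carrier × N.carrier) ∈
          iSup fun g => (M.piece g).prod (N.piece g) := by
        intro y
        induction y using N.isInternal.induction with
        | h0 => exact zero_mem _
        | hadd x y hx hy => simpa using add_mem hx hy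
        | hp g x hx => exact AddSubgroup.mem_iSup_of_mem g ⟨zero_mem _, hx⟩
      simpa using add_mem (h1 x) (h2 y)
  smul_mem ha hx := ⟨M.smul_mem ha hx.1, N.smul_mem ha hx.2⟩

/-- The shift of a graded module: its component of degree `g` is that of degree `g - d`. -/
def shift (M : GradedMod 𝒜) (d : G) : GradedMod 𝒜 where
  carrier := M.carrier
  piece g := M.piece (g - d)
  isInternal := by
    refine isInternal_of_addProj _ (fun g => M.proj (g - d)) ?_ ?_ ?_
    · exact fun g x hx => M.isInternal.proj_self hx
    · exact fun g k hgk x hx => M.isInternal.proj_of_ne (fun e => hgk (sub_left_inj.1 e)) hx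
    · intro x
      induction x using M.isInternal.induction with
      | h0 => exact zero_mem _
      | hadd x y hx hy => exact add_mem hx hy
      | hp g x hx =>
        refine AddSubgroup.mem_iSup_of_mem (g + d) ?_
        rwa [add_sub_cancel_right]
  smul_mem {g h _ _} ha hx := by
    rw [add_sub_assoc]
    exact M.smul_mem ha hx

/-- `M` has a resolution of length less than `n` by finitely generated graded modules that are
projective as modules. -/
def HasFiniteResolution : ℕ → GradedMod 𝒜 → Prop
  | 0, M => Subsingleton M.carrier
  | n + 1, M => ∃ (N P : GradedMod 𝒜) (i : N.Hom P) (f : P.Hom M),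
      Module.Projective A P.carrier ∧ Module.Finite A P.carrier ∧
      Function.Injective i.toLinearMap ∧ Function.Surjective f.toLinearMap ∧
      Function.Exact i.toLinearMap f.toLinearMap ∧ HasFiniteResolution n N

theorem HasFiniteResolution.of_bijective {n : ℕ} {M N : GradedMod 𝒜} (f : M.Hom N)
    (hf : Function.Bijective f.toLinearMap) (hM : M.HasFiniteResolution n) :
    N.HasFiniteResolution n := by
  cases n with
  | zero =>
    have : Subsingleton M.carrier := hM
    exact hf.2.subsingleton
  | succ n =>
    obtain ⟨L, P, i, q, h1, h2, h3, h4, h5, h6⟩ := hM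
    refine ⟨L, P, i, f.comp q, h1, h2, h3, hf.2.comp h4, fun x => ?_, h6⟩
    rw [← h5 x]
    exact ⟨fun h => hf.1 (h.trans (map_zero _).symm),
      fun h => (congrArg f.toLinearMap h).trans (map_zero _)⟩

theorem HasFiniteResolution.hasBounded (h𝒜 : iSup 𝒜 = ⊤) {n : ℕ} {M : GradedMod 𝒜}
    (hM : M.HasFiniteResolution n) : M.HasBoundedFGProjectiveResolution := by
  induction n generalizing M with
  | zero =>
    have : Subsingleton M.carrier := hM
    have h0 : Subsingleton (zero 𝒜).carrier := inferInstanceAs (Subsingleton PUnit)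
    refine ⟨fun _ => zero 𝒜, fun _ => zeroHom _ _, zeroHom _ _, fun _ => ?_, fun _ => ?_,
      ⟨0, fun _ _ => h0⟩, fun x => ⟨0, Subsingleton.elim _ _⟩,
      fun x => ⟨fun _ => ⟨0, Subsingleton.elim _ _⟩, fun _ => Subsingleton.elim _ _⟩,
      fun _ x => ⟨fun _ => ⟨0, Subsingleton.elim _ _⟩, fun _ => Subsingleton.elim _ _⟩⟩
    · exact isProjective_of_projective h𝒜 _
    · infer_instance
  | succ n ih =>
    obtain ⟨N, P, i, f, h1, h2, h3, h4, h5, h6⟩ := hM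
    obtain ⟨Q, d, η, g1, g2, ⟨m, g3⟩, g4, g5, g6⟩ := ih h6
    -- The resolution of the syzygy `N` is moved up by one place and spliced to `P`: the lowest
    -- differential is the composite `Q 0 → N → P`.
    refine ⟨fun k => Nat.casesOn k P Q,
      fun k => Nat.casesOn (motive := fun k => (Q k).Hom (Nat.casesOn k P Q : GradedMod 𝒜))
        k (i.comp η) d, f, ?_, ?_, ⟨m + 1, ?_⟩, h4, ?_, ?_⟩
    · rintro (_ | k)
      · exact isProjective_of_projective h𝒜 P
      · exact g1 k
    · rintro (_ | k)
      · exact h2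
      · exact g2 k
    · rintro (_ | k) hk
      · omega
      · exact g3 k (by omega)
    · intro x
      rw [h5 x]
      constructor
      · rintro ⟨y, rfl⟩
        obtain ⟨z, rfl⟩ := g4 y
        exact ⟨z, rfl⟩
      · rintro ⟨z, rfl⟩
        exact ⟨_, rfl⟩
    · rintro (_ | k)
      · intro x
        rw [← g5 x]
        exact ⟨fun h => h3 (h.trans (map_zero _).symm),
          fun h => (congrArg i.toLinearMap h).trans (map_zero _)⟩
      · exact g6 k

end GradedMod

/-! ### Graded free modules and the comparison of the two notions of resolution. -/

namespace GradedMod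

variable {G : Type v} [AddCommGroup G] [DecidableEq G]
  {K : Type w} [Field K] {A : Type u} [Ring A] [Algebra K A]

section Free

variable (𝒜 : G → Submodule K A) [GradedAlgebra 𝒜]

theorem _root_.GradedAlgebra.isInternal_toAddSubgroup :
    DirectSum.IsInternal fun g => (𝒜 g).toAddSubgroup :=
  DirectSum.Decomposition.isInternal 𝒜

theorem _root_.GradedAlgebra.iSup_eq_top : iSup 𝒜 = ⊤ :=
  (DirectSum.Decomposition.isInternal 𝒜).submodule_iSup_eq_top

/-- The graded free module with basis in the degrees `d i`. -/
noncomputable def free {n : ℕ} (d : Fin n → G) : GradedMod 𝒜 where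
  carrier := Fin n → A
  piece g := AddSubgroup.pi Set.univ fun i => (𝒜 (g - d i)).toAddSubgroup
  isInternal := by
    have h := GradedAlgebra.isInternal_toAddSubgroup 𝒜
    refine isInternal_of_addProj _
      (fun g => AddMonoidHom.pi fun i => (h.proj (g - d i)).comp (Pi.evalAddMonoidHom _ i)) ?_ ?_ ?_
    · exact fun g x hx => funext fun i => h.proj_self (hx i trivial)
    · exact fun g k hgk x hx => funext fun i =>
        h.proj_of_ne (fun e => hgk (sub_left_inj.1 e)) (hx i trivial)
    · intro x
      rw [← Finset.univ_sum_single x]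
      refine sum_mem fun i _ => ?_
      generalize x i = a
      induction a using h.induction with
      | h0 => rw [Pi.single_zero]; exact zero_mem _
      | hadd a b ha hb => rw [Pi.single_add]; exact add_mem ha hb
      | hp g a ha =>
        refine AddSubgroup.mem_iSup_of_mem (g + d i) fun j _ => ?_
        by_cases hij : j = i
        · subst hij
          change (Pi.single j a : Fin n → A) j ∈ 𝒜 (g + d j - d j)
          rw [Pi.single_eq_same, add_sub_cancel_right]
          exact ha
        · rw [Pi.single_eq_of_ne hij]
          exact zero_mem (𝒜 _)
  smul_mem {g h a x} ha hx := by
    intro i _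
    change a * x i ∈ 𝒜 (g + h - d i)
    rw [add_sub_assoc]
    exact SetLike.mul_mem_graded ha (hx i trivial)

variable {𝒜}

instance {n : ℕ} (d : Fin n → G) : Module.Free A (free 𝒜 d).carrier :=
  inferInstanceAs (Module.Free A (Fin n → A))

instance {n : ℕ} (d : Fin n → G) : Module.Finite A (free 𝒜 d).carrier :=
  inferInstanceAs (Module.Finite A (Fin n → A))

/-- The morphism from a graded free module determined by homogeneous images of the basis. -/
noncomputable def freeLift {M : GradedMod 𝒜} {n : ℕ} (d : Fin n → G) (x : Fin n → M.carrier)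
    (hx : ∀ i, x i ∈ M.piece (d i)) : (free 𝒜 d).Hom M where
  toLinearMap := Fintype.linearCombination A x
  map_mem := by
    intro g a ha
    change ∑ i, a i • x i ∈ M.piece g
    refine sum_mem fun i _ => ?_
    have h := M.smul_mem (ha i trivial) (hx i)
    rwa [sub_add_cancel] at h

theorem freeLift_surjective {M : GradedMod 𝒜} {n : ℕ} (d : Fin n → G) (x : Fin n → M.carrier)
    (hx : ∀ i, x i ∈ M.piece (d i)) (hs : Submodule.span A (Set.range x) = ⊤) :
    Function.Surjective (freeLift d x hx).toLinearMap := by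
  rw [← LinearMap.range_eq_top, ← hs]
  exact Fintype.range_linearCombination A x

end Free

variable {𝒜 : G → Submodule K A}

theorem exists_homogeneous_generators (M : GradedMod 𝒜) [Module.Finite A M.carrier] :
    ∃ (n : ℕ) (d : Fin n → G) (x : Fin n → M.carrier), (∀ i, x i ∈ M.piece (d i)) ∧
      Submodule.span A (Set.range x) = ⊤ := by
  classical
  obtain ⟨s, hs⟩ := (Module.Finite.fg_top : (⊤ : Submodule A M.carrier).FG)
  choose t ht ht' using M.isInternal.exists_sum_proj
  let T : Finset (M.carrier × G) := s.biUnion fun x => (t x).image fun g => (x, g)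
  let e := T.equivFin.symm
  refine ⟨T.card, fun i => (e i).1.2, fun i => M.proj (e i).1.2 (e i).1.1,
    fun i => M.isInternal.proj_mem _ _, ?_⟩
  rw [eq_top_iff, ← hs, Submodule.span_le]
  intro x hx
  rw [SetLike.mem_coe, ht' x]
  refine sum_mem fun g hg => Submodule.subset_span ?_
  have hT : (x, g) ∈ T :=
    Finset.mem_biUnion.2 ⟨x, hx, Finset.mem_image.2 ⟨g, hg, rfl⟩⟩
  refine ⟨e.symm ⟨(x, g), hT⟩, ?_⟩
  simp only [Equiv.apply_symm_apply]
  rfl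

/-- Homogeneous generators give a graded free cover; lifting the identity along it makes `P` a
direct summand of a free module. -/
theorem IsProjective.projective [GradedAlgebra 𝒜] {P : GradedMod 𝒜} (hP : P.IsProjective)
    [Module.Finite A P.carrier] : Module.Projective A P.carrier := by
  obtain ⟨n, d, x, hx, hs⟩ := P.exists_homogeneous_generators
  obtain ⟨q, hq⟩ := hP _ _ (freeLift d x hx) (Hom.id P) (freeLift_surjective d x hx hs)
  exact Module.Projective.of_split q.toLinearMap (freeLift d x hx).toLinearMap hq

theorem hasFiniteResolution_of_resolution [GradedAlgebra 𝒜] (n : ℕ) (M : GradedMod 𝒜)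
    (P : ℕ → GradedMod 𝒜) (d : ∀ i, (P (i + 1)).Hom (P i)) (η : (P 0).Hom M)
    (h1 : ∀ i, (P i).IsProjective) (h2 : ∀ i, Module.Finite A (P i).carrier)
    (h3 : ∀ i, n ≤ i → Subsingleton (P i).carrier) (h4 : Function.Surjective η.toLinearMap)
    (h5 : Function.Exact (d 0).toLinearMap η.toLinearMap)
    (h6 : ∀ i, Function.Exact (d (i + 1)).toLinearMap (d i).toLinearMap) :
    M.HasFiniteResolution n := by
  induction n generalizing M P with
  | zero =>
    have := h3 0 le_rfl
    exact h4.subsingleton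
  | succ n ih =>
    have := h2 0
    -- `θ` is the first differential with values in the kernel of `η`; it augments the truncated
    -- complex to a resolution of that kernel.
    obtain ⟨θ, hθ⟩ := (kerι η).exists_factor (kerι_injective η) (d 0)
      fun x => (exact_kerι η _).1 ((h5 _).2 ⟨x, rfl⟩)
    refine ⟨ker η, P 0, kerι η, η, (h1 0).projective, h2 0, kerι_injective η, h4, exact_kerι η,
      ih (ker η) (fun i => P (i + 1)) (fun i => d (i + 1)) θ (fun i => h1 _) (fun i => h2 _)
        (fun i hi => h3 _ (by omega)) (fun x => ?_) (fun x => ?_) fun i => h6 _⟩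
    · obtain ⟨y, hy⟩ := (h5 _).1 x.2
      exact ⟨y, kerι_injective η ((hθ y).trans hy)⟩
    · rw [← h6 0 x, ← hθ]
      exact ⟨fun h => (congrArg (kerι η).toLinearMap h).trans (map_zero _),
        fun h => kerι_injective η (h.trans (map_zero _).symm)⟩

theorem HasBoundedFGProjectiveResolution.exists_hasFiniteResolution [GradedAlgebra 𝒜]
    {M : GradedMod 𝒜} (hM : M.HasBoundedFGProjectiveResolution) :
    ∃ n, M.HasFiniteResolution n := by
  obtain ⟨P, d, η, h1, h2, ⟨n, h3⟩, h4, h5, h6⟩ := hM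
  -- The terms vanish beyond index `n`, so at most the `n + 1` terms from `0` to `n` are nonzero.
  exact ⟨n + 1, hasFiniteResolution_of_resolution (n + 1) M P d η h1 h2
    (fun i hi => h3 i (by omega)) h4 h5 h6⟩

/-- A left regular central element acts injectively on projective modules. -/
theorem _root_.Module.Projective.smul_injective {A M : Type*} [Ring A] [AddCommGroup M] [Module A M]
    [Module.Projective A M] {c : A} (hc : ∀ a, c * a = 0 → a = 0) {x : M} (hx : c • x = 0) :
    x = 0 := by
  obtain ⟨s, hs⟩ := Module.projective_def.1 (inferInstance : Module.Projective A M)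
  have h1 : s x = 0 := by
    ext i
    apply hc
    rw [← smul_eq_mul, ← Finsupp.smul_apply, ← map_smul, hx, map_zero]
    rfl
  rw [← hs x, h1, map_zero]

end GradedMod

open scoped Matrix

/-! ### Quotients by a homogeneous central regular element, and reduction of modules. -/

section Reductions

variable {G : Type v} [AddCommGroup G] [DecidableEq G] {K : Type w} [Field K]
  {S : Type u} [Ring S] [Algebra K S] {T : Type u} [Ring T] [Algebra K T]

/-- A presentation of the graded algebra `T` as the quotient of the graded algebra `S` by a
homogeneous central regular element. -/
structure GradedReduction (𝒮 : G → Submodule K S) (𝒯 : G → Submodule K T) where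
  /-- The quotient map. -/
  φ : S →ₐ[K] T
  surjective : Function.Surjective φ
  /-- The regular element. -/
  c : S
  /-- The degree of the regular element. -/
  d : G
  c_mem : c ∈ 𝒮 d
  comm : ∀ s, c * s = s * c
  regular : ∀ s, c * s = 0 → s = 0
  φ_c : φ c = 0
  exists_of_φ_eq_zero : ∀ s, φ s = 0 → ∃ s', s = c * s'
  map_eq : ∀ g, (𝒮 g).map φ.toLinearMap = 𝒯 g

namespace GradedReduction

variable {𝒮 : G → Submodule K S} {𝒯 : G → Submodule K T} (D : GradedReduction 𝒮 𝒯)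

omit [AddCommGroup G] [DecidableEq G] in
theorem φ_mem {g : G} {s : S} (hs : s ∈ 𝒮 g) : D.φ s ∈ 𝒯 g := by
  rw [← D.map_eq]
  exact ⟨s, hs, rfl⟩

omit [AddCommGroup G] [DecidableEq G] in
theorem exists_mem {g : G} {t : T} (ht : t ∈ 𝒯 g) : ∃ s ∈ 𝒮 g, D.φ s = t := by
  rw [← D.map_eq] at ht
  exact ht

omit [AddCommGroup G] [DecidableEq G] in
theorem smul_comm {M : Type*} [AddCommGroup M] [Module S M] (s : S) (x : M) :
    D.c • s • x = s • D.c • x := by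
  rw [smul_smul, smul_smul, D.comm]

/-- `X` is the reduction of the graded module `M` modulo the element `c`. -/
structure Reduction (M : GradedMod 𝒮) (X : GradedMod 𝒯) where
  /-- The quotient map. -/
  π : M.carrier →+ X.carrier
  map_smul : ∀ s x, π (s • x) = D.φ s • π x
  surjective : Function.Surjective π
  exists_of_π_eq_zero : ∀ x, π x = 0 → ∃ y, x = D.c • y
  π_mem : ∀ g x, x ∈ M.piece g → π x ∈ X.piece g

/-- Restriction of scalars to `S` of a graded `T`-module. -/
def restrict (X : GradedMod 𝒯) : GradedMod 𝒮 where
  carrier := X.carrier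
  module := Module.compHom X.carrier D.φ.toRingHom
  piece := X.piece
  isInternal := X.isInternal
  smul_mem ha hx := X.smul_mem (D.φ_mem ha) hx

/-- Restriction of scalars of morphisms. -/
def restrictHom {X Y : GradedMod 𝒯} (f : X.Hom Y) : (D.restrict X).Hom (D.restrict Y) where
  toLinearMap :=
    { toFun := f.toLinearMap
      map_add' := f.toLinearMap.map_add
      map_smul' := fun s x => f.toLinearMap.map_smul (D.φ s) x }
  map_mem := f.map_mem

/-- A semilinear map of graded modules as a morphism to the restriction of scalars. -/
def Reduction.hom {D : GradedReduction 𝒮 𝒯} {M : GradedMod 𝒮} {X : GradedMod 𝒯}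
    (r : D.Reduction M X) : M.Hom (D.restrict X) where
  toLinearMap :=
    { toFun := r.π
      map_add' := r.π.map_add
      map_smul' := r.map_smul }
  map_mem := r.π_mem

theorem Reduction.π_c {D : GradedReduction 𝒮 𝒯} {M : GradedMod 𝒮} {X : GradedMod 𝒯}
    (r : D.Reduction M X) (x : M.carrier) : r.π (D.c • x) = 0 := by
  rw [r.map_smul, D.φ_c, zero_smul]

section Reduce

variable (M : GradedMod 𝒮)

/-- The submodule `c M` of `M`. -/
def cRange : Submodule S M.carrier where
  carrier := {x | ∃ y, x = D.c • y}
  add_mem' := by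
    rintro _ _ ⟨x, rfl⟩ ⟨y, rfl⟩
    exact ⟨x + y, (smul_add _ _ _).symm⟩
  zero_mem' := ⟨0, (smul_zero _).symm⟩
  smul_mem' := by
    rintro s _ ⟨x, rfl⟩
    exact ⟨s • x, (D.smul_comm s x).symm⟩

theorem smul_quotient_eq (s s' : S) (h : D.φ s = D.φ s') (x : M.carrier ⧸ D.cRange M) :
    s • x = s' • x := by
  obtain ⟨x, rfl⟩ := Submodule.Quotient.mk_surjective _ x
  obtain ⟨r, hr⟩ := D.exists_of_φ_eq_zero (s - s') (by rw [map_sub, h, sub_self])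
  rw [← sub_eq_zero, ← sub_smul, hr, ← Submodule.Quotient.mk_smul, Submodule.Quotient.mk_eq_zero]
  exact ⟨r • x, mul_smul _ _ _⟩

/-- The quotient of a graded module by the multiples of `c`. -/
noncomputable def reduce : GradedMod 𝒯 :=
  letI : SMul T (M.carrier ⧸ D.cRange M) := ⟨fun t x => Function.surjInv D.surjective t • x⟩
  have key : ∀ (s : S) (x : M.carrier ⧸ D.cRange M), D.φ.toRingHom s • x = s • x := fun s x =>
    D.smul_quotient_eq M _ _ (Function.surjInv_eq D.surjective _) x
  letI : Module T (M.carrier ⧸ D.cRange M) :=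
    Function.Surjective.moduleLeft D.φ.toRingHom D.surjective key
  { carrier := M.carrier ⧸ D.cRange M
    piece := fun g => (M.piece g).map (D.cRange M).mkQ.toAddMonoidHom
    isInternal := by
      refine M.isInternal.map_of_surjective _ (Submodule.mkQ_surjective _) ?_
      intro x hx i
      obtain ⟨y, rfl⟩ := (Submodule.Quotient.mk_eq_zero _).1 hx
      refine (Submodule.Quotient.mk_eq_zero _).2 ⟨M.proj (i - D.d) y, ?_⟩
      rw [← M.proj_smul D.c_mem, add_sub_cancel]
      rfl
    smul_mem := by
      rintro g h a _ ha ⟨x, hx, rfl⟩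
      obtain ⟨s, hs, rfl⟩ := D.exists_mem ha
      exact ⟨s • x, M.smul_mem hs hx, (key s ((D.cRange M).mkQ x)).symm⟩ }

/-- The quotient map onto the reduction. -/
noncomputable def toReduce : D.Reduction M (D.reduce M) where
  π := (D.cRange M).mkQ.toAddMonoidHom
  map_smul _ x := (D.smul_quotient_eq M _ _ (Function.surjInv_eq D.surjective _)
    ((D.cRange M).mkQ x)).symm
  surjective := Submodule.mkQ_surjective _
  exists_of_π_eq_zero _ hx := (Submodule.Quotient.mk_eq_zero _).1 hx
  π_mem _ _ hx := ⟨_, hx, rfl⟩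

end Reduce

variable {D}

theorem Reduction.finite {M : GradedMod 𝒮} {X : GradedMod 𝒯} (r : D.Reduction M X)
    [Module.Finite S M.carrier] : Module.Finite T X.carrier := by
  obtain ⟨s, hs⟩ := (Module.Finite.fg_top : (⊤ : Submodule S M.carrier).FG)
  classical
  refine ⟨⟨s.image r.π, ?_⟩⟩
  rw [eq_top_iff]
  intro y _
  obtain ⟨x, rfl⟩ := r.surjective y
  have hx : x ∈ Submodule.span S (s : Set M.carrier) := by rw [hs]; trivial
  induction hx using Submodule.span_induction with
  | mem x hx => exact Submodule.subset_span (by simpa using ⟨x, hx, rfl⟩)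
  | zero => rw [map_zero]; exact zero_mem _
  | add x y _ _ hx hy => rw [map_add]; exact add_mem (hx trivial) (hy trivial)
  | smul a x _ hx => rw [r.map_smul]; exact Submodule.smul_mem _ _ (hx trivial)

/-- Semilinear maps that vanish on the multiples of `c` factor through the reduction. -/
theorem Reduction.exists_desc {M : GradedMod 𝒮} {X : GradedMod 𝒯} (r : D.Reduction M X)
    {Y : Type*} [AddCommGroup Y] [Module T Y] (f : M.carrier →+ Y)
    (hf : ∀ s x, f (s • x) = D.φ s • f x) : ∃ h : X.carrier →ₗ[T] Y, ∀ x, h (r.π x) = f x := by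
  have key : ∀ x x', r.π x = r.π x' → f x = f x' := by
    intro x x' h
    obtain ⟨y, hy⟩ := r.exists_of_π_eq_zero (x - x') (by rw [map_sub, h, sub_self])
    rw [← sub_eq_zero, ← map_sub, hy, hf, D.φ_c, zero_smul]
  let σ := Function.surjInv r.surjective
  have hσ : ∀ y, r.π (σ y) = y := Function.surjInv_eq r.surjective
  refine ⟨{ toFun := fun y => f (σ y), map_add' := fun y y' => ?_, map_smul' := fun t y => ?_ },
    fun x => key _ _ (hσ _)⟩
  · rw [← map_add]
    apply key
    rw [hσ, map_add, hσ, hσ]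
  · obtain ⟨s, rfl⟩ := D.surjective t
    rw [RingHom.id_apply, ← hf]
    apply key
    rw [hσ, r.map_smul, hσ]

theorem Reduction.π_mem_iff_exists {M : GradedMod 𝒮} {X : GradedMod 𝒯} (r : D.Reduction M X)
    {g : G} {y : X.carrier} (hy : y ∈ X.piece g) : ∃ x ∈ M.piece g, r.π x = y :=
  GradedMod.Hom.exists_homogeneous_preimage r.hom r.surjective hy

/-- To split a cover of `X` by a free `T`-module, the quotient map out of `M` is lifted over `S`.
The lift is semilinear with values in a `T`-module, hence kills the multiples of `c` and descends to
`X`. -/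
theorem Reduction.projective {M : GradedMod 𝒮} {X : GradedMod 𝒯} (r : D.Reduction M X)
    [Module.Projective S M.carrier] : Module.Projective T X.carrier := by
  refine Module.Projective.of_lifting_property'' fun {f} hf => ?_
  let _ : Module S (X.carrier →₀ T) := Module.compHom _ D.φ.toRingHom
  let _ : Module S X.carrier := Module.compHom _ D.φ.toRingHom
  let f' : (X.carrier →₀ T) →ₗ[S] X.carrier :=
    { toFun := f
      map_add' := f.map_add
      map_smul' := fun s x => f.map_smul (D.φ s) x }
  let π' : M.carrier →ₗ[S] X.carrier :=
    { toFun := r.π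
      map_add' := r.π.map_add
      map_smul' := r.map_smul }
  obtain ⟨h, hh⟩ := Module.projective_lifting_property f' π' hf
  obtain ⟨k, hk⟩ := r.exists_desc h.toAddMonoidHom fun s x => h.map_smul s x
  refine ⟨k, ?_⟩
  ext y
  obtain ⟨x, rfl⟩ := r.surjective y
  refine (congrArg f (hk x)).trans ?_
  exact LinearMap.congr_fun hh x

end GradedReduction

end Reductions

/-! ### Degree-preserving matrices and the lifting of projective modules. -/

section GradedMatrices

variable {G : Type v} [AddCommGroup G] [DecidableEq G] {K : Type w} [Field K]
  {S : Type u} [Ring S] [Algebra K S]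

/-- The matrices that describe degree-preserving endomorphisms of a graded free module. -/
def gradedMatrices (𝒮 : G → Submodule K S) [GradedAlgebra 𝒮] {n : ℕ} (d : Fin n → G) :
    Subring (Matrix (Fin n) (Fin n) S) where
  carrier := {M | ∀ i j, M i j ∈ 𝒮 (d i - d j)}
  mul_mem' := by
    intro M N hM hN i j
    rw [Matrix.mul_apply]
    refine Submodule.sum_mem _ fun k _ => ?_
    rw [← sub_add_sub_cancel (d i) (d k) (d j)]
    exact SetLike.mul_mem_graded (hM i k) (hN k j)
  one_mem' := by
    intro i j
    rw [Matrix.one_apply]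
    split_ifs with h
    · rw [h, sub_self]
      exact SetLike.one_mem_graded 𝒮
    · exact zero_mem _
  add_mem' hM hN i j := add_mem (hM i j) (hN i j)
  zero_mem' i j := zero_mem _
  neg_mem' hM i j := neg_mem (hM i j)

/-- The endomorphism of a graded free module given by a matrix. -/
def gradedMatrixHom {𝒮 : G → Submodule K S} [GradedAlgebra 𝒮] {n : ℕ} {d : Fin n → G}
    (M : gradedMatrices 𝒮 d) : (GradedMod.free 𝒮 d).Hom (GradedMod.free 𝒮 d) where
  toLinearMap := Matrix.toLinearMapRight' (M : Matrix (Fin n) (Fin n) S)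
  map_mem := by
    intro g x hx j _
    change ∑ i, x i * (M : Matrix (Fin n) (Fin n) S) i j ∈ 𝒮 (g - d j)
    refine Submodule.sum_mem _ fun i _ => ?_
    rw [← sub_add_sub_cancel g (d i) (d j)]
    exact SetLike.mul_mem_graded (hx i trivial) (M.2 i j)

theorem exists_gradedMatrix_of_hom {𝒮 : G → Submodule K S} [GradedAlgebra 𝒮] {n : ℕ}
    {d : Fin n → G} (f : (GradedMod.free 𝒮 d).Hom (GradedMod.free 𝒮 d)) :
    ∃ M : gradedMatrices 𝒮 d, ∀ x : Fin n → S,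
      x ᵥ* (M : Matrix (Fin n) (Fin n) S) = f.toLinearMap x := by
  let M : Matrix (Fin n) (Fin n) S := LinearMap.toMatrixRight' f.toLinearMap
  have hM : ∀ i j, M i j ∈ 𝒮 (d i - d j) := by
    intro i j
    refine f.map_mem (d i) (Pi.single i 1 : Fin n → S) ?_ j trivial
    intro k _
    change (Pi.single i 1 : Fin n → S) k ∈ 𝒮 (d i - d k)
    by_cases h : k = i
    · subst h
      rw [Pi.single_eq_same, sub_self]
      exact SetLike.one_mem_graded 𝒮
    · rw [Pi.single_eq_of_ne h]
      exact zero_mem _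
  exact ⟨⟨M, hM⟩, fun x => LinearMap.congr_fun
    (LinearEquiv.symm_apply_apply LinearMap.toMatrixRight' f.toLinearMap) x⟩

/-- In degree `g`, only the component of `y` of degree `g - k • d` contributes to `c ^ k * y`, and
`δ` is negative there. Homogeneous elements of fixed degree are thus never divisible by high powers
of `c` unless they vanish. -/
theorem GradedAlgebra.eq_zero_of_mem_pow_mul {𝒮 : G → Submodule K S} [GradedAlgebra 𝒮] (δ : G →+ ℤ)
    (hδ : ∀ g, δ g < 0 → 𝒮 g = ⊥) {c : S} {d : G} (hc : c ∈ 𝒮 d) {k : ℕ} {g : G} {s y : S}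
    (hs : s ∈ 𝒮 g) (hy : s = c ^ k * y) (hg : δ g < k * δ d) : s = 0 := by
  have h1 : c ^ k ∈ 𝒮 (k • d) := SetLike.pow_mem_graded k hc
  have h2 := DirectSum.coe_decompose_mul_add_of_left_mem 𝒮 (j := g - k • d) (b := y) h1
  rw [add_sub_cancel, ← hy, DirectSum.decompose_of_mem_same 𝒮 hs] at h2
  have h3 : (DirectSum.decompose 𝒮 y (g - k • d) : S) ∈ 𝒮 (g - k • d) := SetLike.coe_mem _
  have h4 := (hδ (g - k • d) (by rw [map_sub, map_nsmul, nsmul_eq_mul]; omega)).le h3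
  rw [Submodule.mem_bot] at h4
  rw [h2, h4, mul_zero]

variable {T : Type u} [Ring T] [Algebra K T]

namespace GradedReduction

variable {𝒮 : G → Submodule K S} {𝒯 : G → Submodule K T} (D : GradedReduction 𝒮 𝒯)
  [GradedAlgebra 𝒮] [GradedAlgebra 𝒯]

/-- Reduction of graded matrices modulo `c`. -/
def matrixHom {n : ℕ} (d : Fin n → G) : gradedMatrices 𝒮 d →+* Matrix (Fin n) (Fin n) T :=
  D.φ.toRingHom.mapMatrix.comp (gradedMatrices 𝒮 d).subtype

omit [GradedAlgebra 𝒯] in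
theorem exists_pow_eq {n : ℕ} {d : Fin n → G} {M : gradedMatrices 𝒮 d} (hM : D.matrixHom d M = 0)
    (k : ℕ) (i j : Fin n) : ∃ y, ((M ^ k : gradedMatrices 𝒮 d) : Matrix (Fin n) (Fin n) S) i j =
      D.c ^ k * y := by
  have hM' : ∀ i j, D.φ ((M : Matrix (Fin n) (Fin n) S) i j) = 0 :=
    fun i j => congrFun (congrFun hM i) j
  choose N hN using fun i j => D.exists_of_φ_eq_zero _ (hM' i j)
  induction k generalizing i j with
  | zero => exact ⟨_, by rw [pow_zero D.c, one_mul]⟩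
  | succ k ih =>
    choose Y hY using ih
    refine ⟨∑ l, Y i l * N l j, ?_⟩
    rw [pow_succ, Subring.coe_mul, Matrix.mul_apply, Finset.mul_sum]
    refine Finset.sum_congr rfl fun l _ => ?_
    rw [hY, hN, pow_succ, mul_assoc, ← mul_assoc (Y i l), ← D.comm (Y i l), mul_assoc D.c,
      mul_assoc]

omit [GradedAlgebra 𝒯] in
-- The entries of `M ^ k` are divisible by `c ^ k`, while their degrees `d i - d j` do not depend on
-- `k`.
theorem isNilpotent_of_matrixHom_eq_zero (δ : G →+ ℤ) (hδ : ∀ g, δ g < 0 → 𝒮 g = ⊥)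
    (hd : 0 < δ D.d) {n : ℕ} {d : Fin n → G} {M : gradedMatrices 𝒮 d}
    (hM : D.matrixHom d M = 0) : IsNilpotent M := by
  -- One exponent that exceeds every `δ (d i - d j)` at once; as `δ D.d ≥ 1`, it suffices for all
  -- entries.
  let k : ℕ := (∑ i, ∑ j, (δ (d i - d j)).natAbs) + 1
  refine ⟨k, Subtype.ext ?_⟩
  ext i j
  obtain ⟨y, hy⟩ := D.exists_pow_eq hM k i j
  refine GradedAlgebra.eq_zero_of_mem_pow_mul δ hδ D.c_mem ((M ^ k).2 i j) hy ?_
  have h1 : (δ (d i - d j)).natAbs ≤ ∑ i, ∑ j, (δ (d i - d j)).natAbs :=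
    (Finset.single_le_sum (f := fun j => (δ (d i - d j)).natAbs) (fun _ _ => Nat.zero_le _)
      (Finset.mem_univ j)).trans
      (Finset.single_le_sum (f := fun i => ∑ j, (δ (d i - d j)).natAbs) (fun _ _ => Nat.zero_le _)
        (Finset.mem_univ i))
  have h2 : δ (d i - d j) < k := by omega
  nlinarith

theorem exists_matrix_lift {n : ℕ} {d : Fin n → G} (e : gradedMatrices 𝒯 d) :
    ∃ M : gradedMatrices 𝒮 d, D.matrixHom d M = e := by
  choose M hM hM' using fun i j => D.exists_mem (e.2 i j)
  exact ⟨⟨M, hM⟩, Matrix.ext hM'⟩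

/-- Finitely generated graded projective modules lift along the reduction of a nonnegatively
graded algebra modulo a central element of positive degree. -/
theorem exists_projective_lift (δ : G →+ ℤ) (hδ : ∀ g, δ g < 0 → 𝒮 g = ⊥) (hd : 0 < δ D.d)
    (X : GradedMod 𝒯) [Module.Projective T X.carrier] [Module.Finite T X.carrier] :
    ∃ (Q : GradedMod 𝒮) (_ : D.Reduction Q X), Module.Projective S Q.carrier ∧
      Module.Finite S Q.carrier ∧ ∃ m, ∀ g, δ g < m → Q.piece g = ⊥ := by
  obtain ⟨n, d, x, hx, hs⟩ := X.exists_homogeneous_generators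
  let p := GradedMod.freeLift d x hx
  have hp : Function.Surjective p.toLinearMap := GradedMod.freeLift_surjective d x hx hs
  obtain ⟨σ, hσ⟩ := GradedMod.isProjective_of_projective (GradedAlgebra.iSup_eq_top 𝒯) X _ _ p
    (GradedMod.Hom.id X) hp
  replace hσ : ∀ y, p.toLinearMap (σ.toLinearMap y) = y := fun y => LinearMap.congr_fun hσ y
  -- `X` is the summand of a graded free module cut out by the idempotent `σ ∘ p`, written as a
  -- matrix acting on row vectors.
  obtain ⟨e, he⟩ := exists_gradedMatrix_of_hom (σ.comp p)
  replace he : ∀ y : Fin n → T, y ᵥ* (e : Matrix (Fin n) (Fin n) T) =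
      σ.toLinearMap (p.toLinearMap y) := he
  have hidem : IsIdempotentElem (e : Matrix (Fin n) (Fin n) T) := by
    refine Matrix.toLinearMapRight'.injective (LinearMap.ext fun y => ?_)
    change y ᵥ* _ = y ᵥ* _
    rw [← Matrix.vecMul_vecMul, he, he, hσ]
  -- Idempotents lift along a homomorphism whose kernel consists of nilpotents. Working in the ring
  -- of graded matrices makes the lift degree-preserving.
  obtain ⟨E, hE, hEe⟩ := exists_isIdempotentElem_eq_of_ker_isNilpotent (D.matrixHom d)
    (fun M hM => D.isNilpotent_of_matrixHom_eq_zero δ hδ hd hM) _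
    (by obtain ⟨M, hM⟩ := D.exists_matrix_lift e; exact ⟨M, hM⟩) hidem
  let Em : Matrix (Fin n) (Fin n) S := E
  have hE2 : ∀ y : Fin n → S, y ᵥ* Em ᵥ* Em = y ᵥ* Em := fun y => by
    rw [Matrix.vecMul_vecMul]
    exact congrArg (fun M : gradedMatrices 𝒮 d => y ᵥ* (M : Matrix (Fin n) (Fin n) S)) hE
  have hφE : ∀ y : Fin n → S, (D.φ ∘ (y ᵥ* Em)) = (D.φ ∘ y) ᵥ* (e : Matrix (Fin n) (Fin n) T) := by
    intro y
    rw [← hEe]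
    exact funext fun i => RingHom.map_vecMul D.φ.toRingHom Em y i
  -- The image of the idempotent `E`, taken as the kernel of `1 - E` to inherit its grading.
  let Q := GradedMod.ker (gradedMatrixHom (1 - E))
  have hQ : ∀ y : Fin n → S,
      y ∈ LinearMap.ker (gradedMatrixHom (1 - E)).toLinearMap ↔ y ᵥ* Em = y := by
    intro y
    change y ᵥ* (1 - Em) = 0 ↔ _
    rw [Matrix.vecMul_sub, Matrix.vecMul_one, sub_eq_zero, eq_comm]
  let r : (Fin n → S) →ₗ[S] Q.carrier :=
    (Matrix.toLinearMapRight' Em).codRestrict _ fun y => (hQ _).2 (hE2 y)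
  have hr : ∀ y : Q.carrier, r y.1 = y := fun y => Subtype.ext ((hQ _).1 y.2)
  let φF : (Fin n → S) →+ (Fin n → T) :=
    { toFun := fun y => D.φ ∘ y
      map_zero' := funext fun i => map_zero D.φ
      map_add' := fun y z => funext fun i => map_add D.φ _ _ }
  have hφFsurj : Function.Surjective φF := fun y =>
    ⟨fun i => Function.surjInv D.surjective (y i),
      funext fun i => Function.surjInv_eq D.surjective (y i)⟩
  let ρ : D.Reduction Q X :=
    { π := p.toLinearMap.toAddMonoidHom.comp
        (φF.comp (LinearMap.ker (gradedMatrixHom (1 - E)).toLinearMap).subtype.toAddMonoidHom)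
      map_smul := fun s y =>
        (congrArg p.toLinearMap (funext fun i => map_mul D.φ s (y.1 i))).trans
          (p.toLinearMap.map_smul (D.φ s) (φF y.1))
      surjective := fun ξ => by
        obtain ⟨y, hy⟩ := hφFsurj (σ.toLinearMap ξ)
        refine ⟨r y, ?_⟩
        change p.toLinearMap (D.φ ∘ (y ᵥ* Em)) = ξ
        rw [hφE, he]
        change p.toLinearMap (σ.toLinearMap (p.toLinearMap (φF y))) = ξ
        rw [hσ, hy, hσ]
      exists_of_π_eq_zero := fun y hy => by
        have h1 : (D.φ ∘ y.1) = 0 := by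
          have h2 := hφE y.1
          rw [(hQ _).1 y.2, he] at h2
          rw [h2]
          exact (congrArg σ.toLinearMap hy).trans (map_zero _)
        -- The coordinates of `y` are multiples of `c` in the free module; applying the retraction
        -- `r`, which fixes `y`, brings the quotient `z` back into `Q`.
        choose z hz using fun i => D.exists_of_φ_eq_zero (y.1 i) (congrFun h1 i)
        refine ⟨r z, ?_⟩
        rw [← map_smul, ← hr y]
        exact congrArg r (funext hz)
      π_mem := fun g y hy => p.map_mem g _ fun i _ => D.φ_mem (hy i trivial) }
  refine ⟨Q, ρ, ?_, ?_, -∑ i, |δ (d i)|, fun g hg => ?_⟩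
  · exact Module.Projective.of_split (LinearMap.ker (gradedMatrixHom (1 - E)).toLinearMap).subtype r
      (LinearMap.ext hr)
  · exact Module.Finite.of_surjective r fun y => ⟨y.1, hr y⟩
  · rw [eq_bot_iff]
    intro y hy
    refine Subtype.ext (funext fun i => ?_)
    have h1 : y.1 i ∈ 𝒮 (g - d i) := hy i trivial
    have h2 : |δ (d i)| ≤ ∑ i, |δ (d i)| :=
      Finset.single_le_sum (f := fun i => |δ (d i)|) (fun _ _ => abs_nonneg _) (Finset.mem_univ i)
    have h3 := neg_abs_le (δ (d i))
    rw [hδ _ (by rw [map_sub]; omega)] at h1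
    exact h1

end GradedReduction

end GradedMatrices

/-! ### Transfer of finite resolutions along a reduction, in both directions. -/

section ResolutionTransfer

variable {G : Type v} [AddCommGroup G] [DecidableEq G] {K : Type w} [Field K]
  {S : Type u} [Ring S] [Algebra K S] {T : Type u} [Ring T] [Algebra K T]

namespace GradedMod

/-- The components of a graded module vanish in all degrees whose image under `δ` is small. -/
def IsBoundedBelow {𝒮 : G → Submodule K S} (δ : G →+ ℤ) (M : GradedMod 𝒮) : Prop :=
  ∃ m, ∀ g, δ g < m → M.piece g = ⊥

theorem IsBoundedBelow.of_injective {𝒮 : G → Submodule K S} {δ : G →+ ℤ} {M N : GradedMod 𝒮}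
    (hM : M.IsBoundedBelow δ) (i : N.Hom M) (hi : Function.Injective i.toLinearMap) :
    N.IsBoundedBelow δ := by
  obtain ⟨m, hm⟩ := hM
  refine ⟨m, fun g hg => eq_bot_iff.2 fun x hx => hi ?_⟩
  have h := i.map_mem g x hx
  rw [hm g hg] at h
  exact h.trans (map_zero _).symm

/-- The extension of a finite resolution by a finitely generated projective submodule. -/
theorem HasFiniteResolution.extension {𝒮 : G → Submodule K S} (h𝒮 : iSup 𝒮 = ⊤) {m : ℕ}
    {Q L N : GradedMod 𝒮} (i : Q.Hom L) (p : L.Hom N) (hi : Function.Injective i.toLinearMap)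
    (hp : Function.Surjective p.toLinearMap) (hip : Function.Exact i.toLinearMap p.toLinearMap)
    [Module.Projective S Q.carrier] [Module.Finite S Q.carrier] (hN : N.HasFiniteResolution m) :
    L.HasFiniteResolution (max m 1) := by
  cases m with
  | zero =>
    have hN : Subsingleton N.carrier := hN
    have h0 : Subsingleton (zero 𝒮).carrier := inferInstanceAs (Subsingleton PUnit)
    refine ⟨zero 𝒮, Q, zeroHom _ _, i, inferInstance, inferInstance, fun _ _ _ =>
      Subsingleton.elim _ _, fun x => (hip x).1 (Subsingleton.elim _ _), fun x => ⟨fun hx => ?_, ?_⟩,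
      h0⟩
    · exact ⟨0, (map_zero _).trans (hi (hx.trans (map_zero _).symm)).symm⟩
    · rintro ⟨y, rfl⟩
      exact map_zero i.toLinearMap
  | succ m =>
    obtain ⟨N₁, P, j, q, h1, h2, h3, h4, h5, h6⟩ := hN
    rw [max_eq_left (Nat.succ_le_succ (Nat.zero_le m))]
    -- Horseshoe argument: the cover `q` of `N` lifts to `v : P → L`, and `Q ⊕ P` covers `L` with
    -- the same kernel `N₁`, embedded by `(k, j)` where `i ∘ k = -v ∘ j`.
    obtain ⟨v, hv⟩ := isProjective_of_projective h𝒮 P _ _ p q hp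
    replace hv : ∀ x, p.toLinearMap (v.toLinearMap x) = q.toLinearMap x :=
      fun x => LinearMap.congr_fun hv x
    have hpi : ∀ x, p.toLinearMap (i.toLinearMap x) = 0 := fun x => (hip _).2 ⟨x, rfl⟩
    have hqj : ∀ x, q.toLinearMap (j.toLinearMap x) = 0 := fun x => (h5 _).2 ⟨x, rfl⟩
    obtain ⟨k, hk⟩ := i.exists_factor hi
      (⟨-(v.toLinearMap ∘ₗ j.toLinearMap), fun g x hx =>
        neg_mem (v.map_mem _ _ (j.map_mem _ _ hx))⟩ : N₁.Hom L) fun x => (hip _).1 (by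
          change p.toLinearMap (-(v.toLinearMap (j.toLinearMap x))) = 0
          rw [map_neg, hv, hqj, neg_zero])
    replace hk : ∀ x, i.toLinearMap (k.toLinearMap x) = -v.toLinearMap (j.toLinearMap x) := hk
    refine ⟨N₁, Q.prod P, ⟨k.toLinearMap.prod j.toLinearMap, fun g x hx =>
        ⟨k.map_mem g x hx, j.map_mem g x hx⟩⟩,
      ⟨i.toLinearMap.coprod v.toLinearMap, fun g x hx =>
        add_mem (i.map_mem g _ hx.1) (v.map_mem g _ hx.2)⟩,
      inferInstanceAs (Module.Projective S (Q.carrier × P.carrier)),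
      inferInstanceAs (Module.Finite S (Q.carrier × P.carrier)),
      fun x y h => h3 (congrArg Prod.snd h), fun y => ?_, ?_, h6⟩
    · obtain ⟨b, hb⟩ := h4 (p.toLinearMap y)
      obtain ⟨a, ha⟩ := (hip (y - v.toLinearMap b)).1 (by rw [map_sub, hv, hb, sub_self])
      refine ⟨(a, b), ?_⟩
      change i.toLinearMap a + v.toLinearMap b = y
      rw [ha, sub_add_cancel]
    · rintro ⟨a, b⟩
      constructor
      · intro h
        replace h : i.toLinearMap a + v.toLinearMap b = 0 := h
        obtain ⟨x, rfl⟩ := (h5 b).1 (by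
          rw [← hv, eq_neg_of_add_eq_zero_right h, map_neg, hpi, neg_zero])
        refine ⟨x, Prod.ext (hi ?_) rfl⟩
        exact (hk x).trans (eq_neg_of_add_eq_zero_left h).symm
      · rintro ⟨x, hx⟩
        obtain ⟨rfl, rfl⟩ := Prod.ext_iff.1 hx
        change i.toLinearMap (k.toLinearMap x) + v.toLinearMap (j.toLinearMap x) = 0
        rw [hk, neg_add_cancel]

end GradedMod

namespace GradedReduction

variable {𝒮 : G → Submodule K S} {𝒯 : G → Submodule K T} {D : GradedReduction 𝒮 𝒯}

/-- Graded Nakayama lemma. -/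
theorem surjective_of_isBoundedBelow (D : GradedReduction 𝒮 𝒯) {δ : G →+ ℤ} (hd : 0 < δ D.d)
    {Q M : GradedMod 𝒮} (hM : M.IsBoundedBelow δ) (u : Q.Hom M)
    (hu : ∀ x, ∃ q y, x = u.toLinearMap q + D.c • y) : Function.Surjective u.toLinearMap := by
  obtain ⟨m, hm⟩ := hM
  -- Induction on the degree from the lower bound `m`: the homogeneous part of `x = u q + c y`
  -- expresses `x` through an element of degree `g - D.d`, where `δ` is strictly smaller.
  have key : ∀ (k : ℕ) (g : G), δ g < m + k → ∀ x ∈ M.piece g,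
      x ∈ LinearMap.range u.toLinearMap := by
    intro k
    induction k with
    | zero =>
      intro g hg x hx
      rw [hm g (by simpa using hg)] at hx
      rw [show x = 0 from hx]
      exact zero_mem _
    | succ k ih =>
      intro g hg x hx
      obtain ⟨q, y, h⟩ := hu x
      have h1 := M.proj_smul D.c_mem (g - D.d) y
      rw [add_sub_cancel] at h1
      have h2 : x = u.toLinearMap (Q.proj g q) + D.c • M.proj (g - D.d) y := by
        rw [u.map_proj, ← h1, ← map_add, ← h]
        exact (M.isInternal.proj_self hx).symm
      rw [h2]
      refine add_mem ⟨_, rfl⟩ (Submodule.smul_mem _ _ (ih (g - D.d) ?_ _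
        (M.isInternal.proj_mem _ _)))
      rw [map_sub]
      push_cast at hg
      omega
  intro x
  change x ∈ LinearMap.range u.toLinearMap
  induction x using M.isInternal.induction with
  | h0 => exact zero_mem _
  | hadd x y hx hy => exact add_mem hx hy
  | hp g x hx => exact key (δ g - m + 1).toNat g (by omega) x hx

/-- Nakayama applied to the zero morphism from the zero module. -/
theorem subsingleton_of_isBoundedBelow (D : GradedReduction 𝒮 𝒯) {δ : G →+ ℤ} (hd : 0 < δ D.d)
    {M : GradedMod 𝒮} (hM : M.IsBoundedBelow δ) (h : ∀ x : M.carrier, ∃ y, x = D.c • y) :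
    Subsingleton M.carrier := by
  have h1 := D.surjective_of_isBoundedBelow hd hM
    (GradedMod.zeroHom (GradedMod.zero 𝒮) M) fun x => by
      obtain ⟨y, hy⟩ := h x
      exact ⟨0, y, by rw [map_zero, zero_add]; exact hy⟩
  have h0 : Subsingleton (GradedMod.zero 𝒮).carrier := inferInstanceAs (Subsingleton PUnit)
  exact h1.subsingleton

/-- Reduction modulo a regular element is exact on modules on which that element acts
injectively. -/
theorem exists_kernel_reduction {N P M : GradedMod 𝒮} {i : N.Hom P} {f : P.Hom M}
    (hi : Function.Injective i.toLinearMap) (hf : Function.Surjective f.toLinearMap)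
    (hif : Function.Exact i.toLinearMap f.toLinearMap)
    {N' P' X : GradedMod 𝒯} {i' : N'.Hom P'} {f' : P'.Hom X}
    (hi' : Function.Injective i'.toLinearMap)
    (hif' : Function.Exact i'.toLinearMap f'.toLinearMap)
    (ρ : D.Reduction P P') (r : D.Reduction M X)
    (hsq : ∀ x, r.π (f.toLinearMap x) = f'.toLinearMap (ρ.π x))
    (hM : ∀ x : M.carrier, D.c • x = 0 → x = 0) : Nonempty (D.Reduction N N') := by
  have hfi : ∀ x, f.toLinearMap (i.toLinearMap x) = 0 := fun x => (hif _).2 ⟨x, rfl⟩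
  have hfi' : ∀ x, f'.toLinearMap (i'.toLinearMap x) = 0 := fun x => (hif' _).2 ⟨x, rfl⟩
  obtain ⟨h, hh⟩ := (D.restrictHom i').exists_factor hi' (ρ.hom.comp i) fun x =>
    (hif' _).1 (by
      change f'.toLinearMap (ρ.π (i.toLinearMap x)) = 0
      rw [← hsq, hfi, map_zero])
  replace hh : ∀ x, i'.toLinearMap (h.toLinearMap x) = ρ.π (i.toLinearMap x) := hh
  refine ⟨⟨h.toLinearMap.toAddMonoidHom, h.toLinearMap.map_smul, fun y => ?_, fun x hx => ?_,
    h.map_mem⟩⟩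
  · obtain ⟨q, hq⟩ := ρ.surjective (i'.toLinearMap y)
    obtain ⟨m, hm⟩ := r.exists_of_π_eq_zero (f.toLinearMap q) (by rw [hsq, hq, hfi'])
    obtain ⟨q', rfl⟩ := hf m
    obtain ⟨x, hx⟩ := (hif (q - D.c • q')).1 (by rw [map_sub, map_smul, hm, sub_self])
    refine ⟨x, hi' ((hh x).trans ?_)⟩
    rw [hx, map_sub, ρ.π_c, sub_zero, hq]
  · obtain ⟨y, hy⟩ := ρ.exists_of_π_eq_zero (i.toLinearMap x) (by
      rw [← hh]
      exact (congrArg i'.toLinearMap hx).trans (map_zero _))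
    -- Here torsion-freeness of `M` enters: `c • f y = f (i x) = 0` forces `f y = 0`, so the
    -- quotient `y` already lies in `N`.
    obtain ⟨z, rfl⟩ := (hif y).1 (hM _ (by rw [← map_smul, ← hy, hfi]))
    exact ⟨z, hi (by rw [hy, map_smul])⟩

/-- If the reduction of a graded module that is bounded below and torsion free has a finite
resolution, then so does the module. -/
theorem hasFiniteResolution_of_reduction [GradedAlgebra 𝒮] [GradedAlgebra 𝒯] {δ : G →+ ℤ}
    (hδ : ∀ g, δ g < 0 → 𝒮 g = ⊥) (hd : 0 < δ D.d) {n : ℕ} {M : GradedMod 𝒮} {X : GradedMod 𝒯}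
    (r : D.Reduction M X) (hMb : M.IsBoundedBelow δ) (hM : ∀ x : M.carrier, D.c • x = 0 → x = 0)
    (hX : X.HasFiniteResolution n) : M.HasFiniteResolution n := by
  induction n generalizing M X with
  | zero =>
    have hX : Subsingleton X.carrier := hX
    exact D.subsingleton_of_isBoundedBelow hd hMb fun x =>
      r.exists_of_π_eq_zero x (Subsingleton.elim _ _)
  | succ n ih =>
    obtain ⟨N', P', i', f', h1, h2, h3, h4, h5, h6⟩ := hX
    obtain ⟨Q, ρ, hQ1, hQ2, hQ3⟩ := D.exists_projective_lift δ hδ hd P'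
    -- The composite `Q → P' → X` lifts through `M → X`; modulo `c` the lift `u` is surjective, and
    -- Nakayama removes "modulo `c`".
    obtain ⟨u, hu⟩ := GradedMod.isProjective_of_projective (GradedAlgebra.iSup_eq_top 𝒮) Q _ _
      r.hom ((D.restrictHom f').comp ρ.hom) r.surjective
    replace hu : ∀ x, r.π (u.toLinearMap x) = f'.toLinearMap (ρ.π x) :=
      fun x => LinearMap.congr_fun hu x
    have husurj := D.surjective_of_isBoundedBelow hd hMb u fun x => by
      obtain ⟨y, hy⟩ := h4 (r.π x)
      obtain ⟨q, rfl⟩ := ρ.surjective y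
      obtain ⟨z, hz⟩ := r.exists_of_π_eq_zero (x - u.toLinearMap q) (by
        rw [map_sub, hu, hy, sub_self])
      exact ⟨q, z, by rw [← hz, add_sub_cancel]⟩
    obtain ⟨rN⟩ := exists_kernel_reduction (GradedMod.kerι_injective u) husurj
      (GradedMod.exact_kerι u) h3 h5 ρ r hu hM
    refine ⟨GradedMod.ker u, Q, GradedMod.kerι u, u, hQ1, hQ2, GradedMod.kerι_injective u, husurj,
      GradedMod.exact_kerι u, ih rN (GradedMod.IsBoundedBelow.of_injective hQ3 _
        (GradedMod.kerι_injective u)) (fun x hx => ?_) h6⟩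
    refine GradedMod.kerι_injective u ?_
    rw [map_zero]
    -- The kernel of `u` is torsion free because it lies in the projective module `Q`, so the
    -- induction can continue.
    refine Module.Projective.smul_injective D.regular ?_
    rw [← map_smul, hx, map_zero]

/-- If a torsion free graded module has a finite resolution, then so does its reduction. -/
theorem Reduction.hasFiniteResolution {n : ℕ} {M : GradedMod 𝒮} {X : GradedMod 𝒯}
    (r : D.Reduction M X) (hM : ∀ x : M.carrier, D.c • x = 0 → x = 0)
    (h : M.HasFiniteResolution n) : X.HasFiniteResolution n := by
  induction n generalizing M X with
  | zero =>
    have h : Subsingleton M.carrier := h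
    exact r.surjective.subsingleton
  | succ n ih =>
    obtain ⟨N, P, i, f, h1, h2, h3, h4, h5, h6⟩ := h
    let ρ := D.toReduce P
    obtain ⟨k, hk⟩ := ρ.exists_desc (r.π.comp f.toLinearMap.toAddMonoidHom) fun s x => by
      change r.π (f.toLinearMap (s • x)) = D.φ s • r.π (f.toLinearMap x)
      rw [f.toLinearMap.map_smul, r.map_smul]
    replace hk : ∀ x, k (ρ.π x) = r.π (f.toLinearMap x) := hk
    let f' : (D.reduce P).Hom X := ⟨k, fun g y hy => by
      obtain ⟨x, hx, rfl⟩ := ρ.π_mem_iff_exists hy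
      rw [hk]
      exact r.π_mem _ _ (f.map_mem _ _ hx)⟩
    obtain ⟨rN⟩ := exists_kernel_reduction h3 h4 h5 (GradedMod.kerι_injective f')
      (GradedMod.exact_kerι f') ρ r (fun x => (hk x).symm) hM
    refine ⟨GradedMod.ker f', D.reduce P, GradedMod.kerι f', f', ρ.projective, ρ.finite,
      GradedMod.kerι_injective f', fun y => ?_, GradedMod.exact_kerι f', ih rN (fun x hx => ?_) h6⟩
    · obtain ⟨x, rfl⟩ := r.surjective y
      obtain ⟨z, rfl⟩ := h4 x
      exact ⟨ρ.π z, hk z⟩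
    · refine h3 ?_
      rw [map_zero]
      refine Module.Projective.smul_injective D.regular ?_
      rw [← i.toLinearMap.map_smul, hx, map_zero]

/-- Multiplication by the central element as a morphism of graded modules. -/
def mulC (D : GradedReduction 𝒮 𝒯) (Q : GradedMod 𝒮) : (Q.shift D.d).Hom Q where
  toLinearMap :=
    { toFun := fun x : Q.carrier => D.c • x
      map_add' := fun x y => smul_add (M := S) (A := Q.carrier) _ x y
      map_smul' := fun s x => D.smul_comm (M := Q.carrier) s x }
  map_mem g x hx := by
    have h := Q.smul_mem D.c_mem hx
    rwa [add_sub_cancel] at h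

/-- If a graded module over the quotient has a finite resolution, then so does its restriction
of scalars. -/
theorem exists_hasFiniteResolution_restrict [GradedAlgebra 𝒮] [GradedAlgebra 𝒯] {δ : G →+ ℤ}
    (hδ : ∀ g, δ g < 0 → 𝒮 g = ⊥) (hd : 0 < δ D.d) {n : ℕ} {X : GradedMod 𝒯}
    (hX : X.HasFiniteResolution n) : ∃ m, (D.restrict X).HasFiniteResolution m := by
  induction n generalizing X with
  | zero => exact ⟨0, hX⟩
  | succ n ih =>
    obtain ⟨N', P', i', f', h1, h2, h3, h4, h5, h6⟩ := hX
    obtain ⟨m, hm⟩ := ih h6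
    obtain ⟨Q, ρ, hQ1, hQ2, -⟩ := D.exists_projective_lift δ hδ hd P'
    let v : Q.Hom (D.restrict X) := (D.restrictHom f').comp ρ.hom
    have hv : ∀ x, v.toLinearMap x = f'.toLinearMap (ρ.π x) := fun _ => rfl
    have hfi' : ∀ x, f'.toLinearMap (i'.toLinearMap x) = 0 := fun x => (h5 _).2 ⟨x, rfl⟩
    -- The kernel of `v : Q → P' → X` is the preimage of `N'` in `Q`. It is an extension of `N'` by
    -- `c Q`, and `c Q` is a shifted copy of `Q` since `c` is regular; so the induction hypothesis
    -- for `N'` applies through `HasFiniteResolution.extension`.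
    obtain ⟨p, hp⟩ := (D.restrictHom i').exists_factor h3 (ρ.hom.comp (GradedMod.kerι v))
      fun x => (h5 _).1 x.2
    replace hp : ∀ x, i'.toLinearMap (p.toLinearMap x) = ρ.π x.1 := hp
    obtain ⟨i, hi⟩ := (GradedMod.kerι v).exists_factor (GradedMod.kerι_injective v) (D.mulC Q)
      fun x => (GradedMod.exact_kerι v _).1 (by
        change f'.toLinearMap (ρ.π (D.c • (x : Q.carrier))) = 0
        exact (congrArg f'.toLinearMap (ρ.π_c x)).trans (map_zero _))
    replace hi : ∀ x : Q.carrier, (i.toLinearMap x).1 = D.c • x := hi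
    have : Module.Projective S (Q.shift D.d).carrier := hQ1
    have : Module.Finite S (Q.shift D.d).carrier := hQ2
    refine ⟨max m 1 + 1, GradedMod.ker v, Q, GradedMod.kerι v, v, hQ1, hQ2, GradedMod.kerι_injective v,
      fun x => ?_, GradedMod.exact_kerι v, GradedMod.HasFiniteResolution.extension
        (GradedAlgebra.iSup_eq_top 𝒮) i p ?_ (fun y => ?_) (fun x => ?_) hm⟩
    · obtain ⟨y, rfl⟩ := h4 x
      obtain ⟨z, rfl⟩ := ρ.surjective y
      exact ⟨z, rfl⟩
    · rw [injective_iff_map_eq_zero]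
      intro x hx
      exact Module.Projective.smul_injective (M := Q.carrier) D.regular
        ((hi x).symm.trans (congrArg Subtype.val hx))
    · obtain ⟨q, hq⟩ := ρ.surjective (i'.toLinearMap y)
      refine ⟨⟨q, ?_⟩, h3 ?_⟩
      · exact (congrArg f'.toLinearMap hq).trans (hfi' y)
      · exact (hp _).trans hq
    · constructor
      · intro hx
        obtain ⟨y, hy⟩ := ρ.exists_of_π_eq_zero x.1 (by
          rw [← hp]
          exact (congrArg i'.toLinearMap hx).trans (map_zero _))
        exact ⟨y, Subtype.ext ((hi y).trans hy.symm)⟩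
      · rintro ⟨y, rfl⟩
        exact h3 ((hp _).trans ((congrArg ρ.π (hi y)).trans
          ((ρ.π_c (y : Q.carrier)).trans (map_zero i'.toLinearMap).symm)))

end GradedReduction

end ResolutionTransfer

/-! ### Coarsening of gradings along a group homomorphism. -/

section Coarsening

variable {G : Type v} [AddCommGroup G] [DecidableEq G] {H : Type v} [AddCommGroup H]
  [DecidableEq H] {K : Type w} [Field K] {S : Type u} [Ring S] [Algebra K S]

/-- The grading by `H` that a grading by `G` induces along a homomorphism `G → H`. -/
def coarseGrading (γ : G →+ H) (𝒮 : G → Submodule K S) (h : H) : Submodule K S :=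
  ⨆ i : {i // γ i = h}, 𝒮 i

namespace GradedMod

variable (γ : G →+ H) {𝒮 : G → Submodule K S}

/-- A graded module with its grading coarsened along a homomorphism. -/
def coarsen (M : GradedMod 𝒮) : GradedMod (coarseGrading γ 𝒮) where
  carrier := M.carrier
  piece h := ⨆ i : {i // γ i = h}, M.piece i
  isInternal := by
    let π : H → M.carrier →+ M.carrier := fun h =>
      M.isInternal.liftAddHom fun i => if γ i = h then (M.piece i).subtype else 0
    have h1 : ∀ h i x, x ∈ M.piece i → γ i = h → π h x = x := fun h i x hx e => by
      change M.isInternal.liftAddHom _ x = _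
      rw [M.isInternal.liftAddHom_apply _ hx, if_pos e]
      rfl
    have h2 : ∀ h i x, x ∈ M.piece i → γ i ≠ h → π h x = 0 := fun h i x hx e => by
      change M.isInternal.liftAddHom _ x = _
      rw [M.isInternal.liftAddHom_apply _ hx, if_neg e]
      rfl
    refine isInternal_of_addProj _ π (fun h x hx => ?_) (fun h k hhk x hx => ?_) fun x => ?_
    · refine AddSubgroup.iSup_induction _ (C := fun x => π h x = x) hx (fun i x hx => h1 h i x hx i.2)
        (map_zero _) fun x y hx hy => by rw [map_add, hx, hy]
    · refine AddSubgroup.iSup_induction _ (C := fun x => π k x = 0) hx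
        (fun i x hx => h2 k i x hx fun e => hhk (i.2.symm.trans e))
        (map_zero _) fun x y hx hy => by rw [map_add, hx, hy, add_zero]
    · induction x using M.isInternal.induction with
      | h0 => exact zero_mem _
      | hadd x y hx hy => exact add_mem hx hy
      | hp g x hx =>
        exact AddSubgroup.mem_iSup_of_mem (γ g)
          (AddSubgroup.mem_iSup_of_mem (⟨g, rfl⟩ : {i // γ i = γ g}) hx)
  smul_mem {h k a x} ha hx := by
    refine AddSubgroup.iSup_induction _ (C := fun x => a • x ∈ ⨆ i : {i // γ i = h + k}, M.piece i)
      hx (fun j x hx => ?_) (by rw [smul_zero]; exact zero_mem _)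
      fun x y hx hy => by rw [smul_add]; exact add_mem hx hy
    refine Submodule.iSup_induction _
      (motive := fun a => a • x ∈ ⨆ i : {i // γ i = h + k}, M.piece i)
      ha (fun i a ha => ?_) (by rw [zero_smul]; exact zero_mem _)
      fun x y hx hy => by rw [add_smul]; exact add_mem hx hy
    exact AddSubgroup.mem_iSup_of_mem
      (⟨i + j, by rw [map_add, i.2, j.2]⟩ : {i // γ i = h + k}) (M.smul_mem ha hx)

/-- A morphism of graded modules as a morphism for the coarsened gradings. -/
def Hom.coarsen {M N : GradedMod 𝒮} (f : M.Hom N) : (M.coarsen γ).Hom (N.coarsen γ) where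
  toLinearMap := f.toLinearMap
  map_mem h x hx := by
    refine AddSubgroup.iSup_induction _
      (C := fun x => f.toLinearMap x ∈ ⨆ i : {i // γ i = h}, N.piece i)
      hx (fun j x hx => AddSubgroup.mem_iSup_of_mem j (f.map_mem _ _ hx))
      (by rw [map_zero]; exact zero_mem _) fun x y hx hy => by rw [map_add]; exact add_mem hx hy

theorem HasFiniteResolution.coarsen {n : ℕ} {M : GradedMod 𝒮} (hM : M.HasFiniteResolution n) :
    (M.coarsen γ).HasFiniteResolution n := by
  induction n generalizing M with
  | zero => exact hM
  | succ n ih =>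
    obtain ⟨N, P, i, f, h1, h2, h3, h4, h5, h6⟩ := hM
    exact ⟨N.coarsen γ, P.coarsen γ, i.coarsen γ, f.coarsen γ, h1, h2, h3, h4, h5, ih h6⟩

end GradedMod

end Coarsening

/-! ### Enveloping algebras: grading, functoriality and the kernel over a central quotient. -/

section Enveloping

variable {G : Type v} [AddCommGroup G] [DecidableEq G]
  {K : Type w} [Field K] {A : Type u} [Ring A] [Algebra K A]

/-- The projection of the enveloping algebra onto its component of degree `g`. -/
noncomputable def envelopingProj (𝒜 : G → Submodule K A) [GradedAlgebra 𝒜] (g : G) :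
    A ⊗[K] Aᵐᵒᵖ →ₗ[K] A ⊗[K] Aᵐᵒᵖ :=
  TensorProduct.lift ((DirectSum.toModule K G (Aᵐᵒᵖ →ₗ[K] A ⊗[K] Aᵐᵒᵖ) fun i =>
    (TensorProduct.mk K A Aᵐᵒᵖ).compl₂ ((MulOpposite.opLinearEquiv K).toLinearMap ∘ₗ
      GradedAlgebra.proj 𝒜 (g - i) ∘ₗ (MulOpposite.opLinearEquiv K).symm.toLinearMap) ∘ₗ
      (𝒜 i).subtype) ∘ₗ (DirectSum.decomposeLinearEquiv 𝒜).toLinearMap)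

theorem envelopingProj_tmul (𝒜 : G → Submodule K A) [GradedAlgebra 𝒜] (g : G) {i : G} {a : A}
    (ha : a ∈ 𝒜 i) (b : A) : envelopingProj 𝒜 g (a ⊗ₜ[K] MulOpposite.op b) =
      a ⊗ₜ[K] MulOpposite.op (GradedAlgebra.proj 𝒜 (g - i) b) := by
  lift a to 𝒜 i using ha
  simp only [envelopingProj, TensorProduct.lift.tmul, LinearMap.comp_apply,
    LinearEquiv.coe_coe, DirectSum.decomposeLinearEquiv_apply, DirectSum.decompose_coe]
  rw [← DirectSum.lof_eq_of K, DirectSum.toModule_lof]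
  rfl

omit [DecidableEq G] in
theorem tmul_mem_envelopingGrading {𝒜 : G → Submodule K A} {i j : G} {a b : A} (ha : a ∈ 𝒜 i)
    (hb : b ∈ 𝒜 j) : a ⊗ₜ[K] MulOpposite.op b ∈ envelopingGrading 𝒜 (i + j) :=
  Submodule.subset_span ⟨i, j, rfl, a, ha, b, hb, rfl⟩

theorem envelopingGrading_isInternal (𝒜 : G → Submodule K A) [GradedAlgebra 𝒜] :
    DirectSum.IsInternal (envelopingGrading 𝒜) := by
  refine isInternal_of_proj _ (envelopingProj 𝒜) (fun g z hz => ?_) (fun g h hgh z hz => ?_)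
    fun z => ?_
  · induction hz using Submodule.span_induction with
    | zero => exact map_zero _
    | add x y _ _ hx hy => rw [map_add, hx, hy]
    | smul k x _ hx => rw [map_smul, hx]
    | mem x hx =>
      obtain ⟨i, j, rfl, a, ha, b, hb, rfl⟩ := hx
      rw [envelopingProj_tmul 𝒜 _ ha, add_sub_cancel_left, GradedAlgebra.proj_apply,
        DirectSum.decompose_of_mem_same 𝒜 hb]
  · induction hz using Submodule.span_induction with
    | zero => exact map_zero _
    | add x y _ _ hx hy => rw [map_add, hx, hy, add_zero]
    | smul k x _ hx => rw [map_smul, hx, smul_zero]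
    | mem x hx =>
      obtain ⟨i, j, rfl, a, ha, b, hb, rfl⟩ := hx
      rw [envelopingProj_tmul 𝒜 _ ha, GradedAlgebra.proj_apply,
        DirectSum.decompose_of_mem_ne 𝒜 hb (fun e => hgh (by rw [e, add_sub_cancel])),
        MulOpposite.op_zero, TensorProduct.tmul_zero]
  · induction z using TensorProduct.induction_on with
    | zero => exact zero_mem _
    | add x y hx hy => exact add_mem hx hy
    | tmul a b =>
      obtain ⟨b, rfl⟩ := MulOpposite.op_surjective b
      have ha : a ∈ iSup 𝒜 := by rw [GradedAlgebra.iSup_eq_top]; trivial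
      have hb : b ∈ iSup 𝒜 := by rw [GradedAlgebra.iSup_eq_top]; trivial
      induction ha using Submodule.iSup_induction' with
      | zero => rw [TensorProduct.zero_tmul]; exact zero_mem _
      | add x y _ _ hx hy => rw [TensorProduct.add_tmul]; exact add_mem hx hy
      | mem i a ha =>
        induction hb using Submodule.iSup_induction' with
        | zero => rw [MulOpposite.op_zero, TensorProduct.tmul_zero]; exact zero_mem _
        | add x y _ _ hx hy =>
          rw [MulOpposite.op_add, TensorProduct.tmul_add]
          exact add_mem hx hy
        | mem j b hb => exact Submodule.mem_iSup_of_mem _ (tmul_mem_envelopingGrading ha hb)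

theorem envelopingGrading_gradedMonoid (𝒜 : G → Submodule K A) [GradedAlgebra 𝒜] :
    SetLike.GradedMonoid (envelopingGrading 𝒜) where
  one_mem := by
    have h := tmul_mem_envelopingGrading (SetLike.one_mem_graded 𝒜) (SetLike.one_mem_graded 𝒜)
    rwa [add_zero] at h
  mul_mem := by
    intro g h x y hx hy
    have key : envelopingGrading 𝒜 g * envelopingGrading 𝒜 h ≤ envelopingGrading 𝒜 (g + h) := by
      unfold envelopingGrading
      rw [Submodule.span_mul_span, Submodule.span_le]
      rintro _ ⟨_, ⟨i, j, rfl, a, ha, b, hb, rfl⟩, _, ⟨i', j', rfl, a', ha', b', hb', rfl⟩, rfl⟩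
      have h1 := tmul_mem_envelopingGrading (SetLike.mul_mem_graded ha ha')
        (SetLike.mul_mem_graded hb' hb)
      rw [show i + i' + (j' + j) = i + j + (i' + j') by abel] at h1
      change (a ⊗ₜ[K] MulOpposite.op b) * (a' ⊗ₜ[K] MulOpposite.op b') ∈ _
      rw [Algebra.TensorProduct.tmul_mul_tmul, ← MulOpposite.op_mul]
      exact h1
    exact key (Submodule.mul_mem_mul hx hy)

noncomputable instance (𝒜 : G → Submodule K A) [GradedAlgebra 𝒜] :
    GradedAlgebra (envelopingGrading 𝒜) :=
  letI := envelopingGrading_gradedMonoid 𝒜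
  letI := (envelopingGrading_isInternal 𝒜).chooseDecomposition
  { }

/-- The image of a graded algebra under a surjective homomorphism with homogeneous kernel is
graded. -/
theorem GradedAlgebra.nonempty_map {B : Type*} [Ring B] [Algebra K B] (𝒜 : G → Submodule K A)
    [GradedAlgebra 𝒜] (f : A →ₐ[K] B) (hf : Function.Surjective f)
    (hk : ∀ a, f a = 0 → ∀ g, f (DirectSum.decompose 𝒜 a g) = 0) :
    Nonempty (GradedAlgebra fun g => (𝒜 g).map f.toLinearMap) := by
  let _ : SetLike.GradedMonoid fun g => (𝒜 g).map f.toLinearMap :=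
    { one_mem := ⟨1, SetLike.one_mem_graded 𝒜, map_one f⟩
      mul_mem := by
        rintro i j _ _ ⟨p, hp, rfl⟩ ⟨q, hq, rfl⟩
        exact ⟨p * q, SetLike.mul_mem_graded hp hq, map_mul f p q⟩ }
  have h := GradedAlgebra.isInternal_toAddSubgroup 𝒜
  have hproj : ∀ g a, h.proj g a = DirectSum.decompose 𝒜 a g := by
    intro g a
    induction a using h.induction with
    | h0 => simp
    | hadd x y hx hy => rw [map_add, hx, hy, DirectSum.decompose_add]; rfl
    | hp i x hx =>
      by_cases hi : i = g
      · subst hi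
        rw [h.proj_self hx, DirectSum.decompose_of_mem_same 𝒜 hx]
      · rw [h.proj_of_ne hi hx, DirectSum.decompose_of_mem_ne 𝒜 hx hi]
  have h2 : DirectSum.IsInternal fun g => (𝒜 g).map f.toLinearMap :=
    h.map_of_surjective f.toLinearMap.toAddMonoidHom hf fun a ha g => by
      rw [hproj]
      exact hk a ha g
  let _ := h2.chooseDecomposition
  exact ⟨{ }⟩

variable {B : Type u} [Ring B] [Algebra K B]

/-- The homomorphism of enveloping algebras induced by a homomorphism of algebras. -/
noncomputable def envelopingMap (f : A →ₐ[K] B) : A ⊗[K] Aᵐᵒᵖ →ₐ[K] B ⊗[K] Bᵐᵒᵖ :=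
  Algebra.TensorProduct.map f (AlgHom.op f)

theorem envelopingMap_tmul (f : A →ₐ[K] B) (a b : A) :
    envelopingMap f (a ⊗ₜ[K] MulOpposite.op b) = f a ⊗ₜ[K] MulOpposite.op (f b) := rfl

theorem envelopingMap_surjective {f : A →ₐ[K] B} (hf : Function.Surjective f) :
    Function.Surjective (envelopingMap f) :=
  TensorProduct.map_surjective hf fun b => by
    obtain ⟨a, ha⟩ := hf b.unop
    exact ⟨MulOpposite.op a, congrArg MulOpposite.op ha⟩

omit [DecidableEq G] in
theorem envelopingMap_mem {H : Type v} [AddCommGroup H] {𝒜 : G → Submodule K A}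
    {ℬ : H → Submodule K B} {f : A →ₐ[K] B} (γ : G →+ H) (hf : ∀ i, ∀ a ∈ 𝒜 i, f a ∈ ℬ (γ i))
    {g : G} {z : A ⊗[K] Aᵐᵒᵖ} (hz : z ∈ envelopingGrading 𝒜 g) :
    envelopingMap f z ∈ envelopingGrading ℬ (γ g) := by
  have key : envelopingGrading 𝒜 g ≤
      (envelopingGrading ℬ (γ g)).comap (envelopingMap f).toLinearMap := by
    refine Submodule.span_le.2 ?_
    rintro _ ⟨i, j, rfl, a, ha, b, hb, rfl⟩
    rw [map_add]
    exact tmul_mem_envelopingGrading (hf i a ha) (hf j b hb)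
  exact key hz

/-- Left multiplication by `a ⊗ 1`. -/
theorem tmul_one_mul (a : A) (z : A ⊗[K] Aᵐᵒᵖ) :
    (a ⊗ₜ[K] (1 : Aᵐᵒᵖ)) * z = LinearMap.rTensor Aᵐᵒᵖ (LinearMap.mulLeft K a) z := by
  induction z using TensorProduct.induction_on with
  | zero => simp
  | add x y hx hy => rw [mul_add, hx, hy, map_add]
  | tmul x y => simp

/-- Left multiplication by `1 ⊗ b`. -/
theorem one_tmul_mul (b : Aᵐᵒᵖ) (z : A ⊗[K] Aᵐᵒᵖ) :
    ((1 : A) ⊗ₜ[K] b) * z = LinearMap.lTensor A (LinearMap.mulLeft K b) z := by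
  induction z using TensorProduct.induction_on with
  | zero => simp
  | add x y hx hy => rw [mul_add, hx, hy, map_add]
  | tmul x y => simp

theorem tmul_one_comm {a : A} (ha : ∀ x, a * x = x * a) (z : A ⊗[K] Aᵐᵒᵖ) :
    (a ⊗ₜ[K] (1 : Aᵐᵒᵖ)) * z = z * (a ⊗ₜ[K] (1 : Aᵐᵒᵖ)) := by
  induction z using TensorProduct.induction_on with
  | zero => simp
  | add x y hx hy => rw [mul_add, hx, hy, add_mul]
  | tmul x y => simp [ha]

theorem one_tmul_comm {a : A} (ha : ∀ x, a * x = x * a) (z : A ⊗[K] Aᵐᵒᵖ) :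
    ((1 : A) ⊗ₜ[K] MulOpposite.op a) * z = z * ((1 : A) ⊗ₜ[K] MulOpposite.op a) := by
  induction z using TensorProduct.induction_on with
  | zero => simp
  | add x y hx hy => rw [mul_add, hx, hy, add_mul]
  | tmul x y =>
    obtain ⟨y, rfl⟩ := MulOpposite.op_surjective y
    simp [← MulOpposite.op_mul, ha]

section CentralKernel

variable {f : A →ₐ[K] B} {a : A} (hf : Function.Surjective f) (ha : ∀ x, a * x = x * a)
  (hfa : f a = 0) (hk : ∀ x, f x = 0 → ∃ y, x = a * y)
include hfa hk

theorem exact_mulLeft : Function.Exact (LinearMap.mulLeft K a) f.toLinearMap := fun x =>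
  ⟨fun hx => by
    obtain ⟨y, rfl⟩ := hk x hx
    exact ⟨y, rfl⟩, by
    rintro ⟨y, rfl⟩
    change f (a * y) = 0
    rw [map_mul, hfa, zero_mul]⟩

include ha in
theorem exact_mulLeft_op : Function.Exact (LinearMap.mulLeft K (MulOpposite.op a))
    (AlgHom.op f).toLinearMap := fun x =>
  ⟨fun hx => by
    obtain ⟨x, rfl⟩ := MulOpposite.op_surjective x
    obtain ⟨y, rfl⟩ := hk x (MulOpposite.op_injective hx)
    exact ⟨MulOpposite.op y, by
      rw [LinearMap.mulLeft_apply, ← MulOpposite.op_mul, ha]⟩, by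
    rintro ⟨y, rfl⟩
    refine MulOpposite.unop_injective ?_
    change f (y.unop * a) = 0
    rw [map_mul, hfa, mul_zero]⟩

include hf

theorem exists_of_rTensor_eq_zero {z : A ⊗[K] Aᵐᵒᵖ}
    (hz : LinearMap.rTensor Aᵐᵒᵖ f.toLinearMap z = 0) : ∃ x, z = (a ⊗ₜ[K] (1 : Aᵐᵒᵖ)) * x := by
  obtain ⟨x, hx⟩ := (rTensor_exact Aᵐᵒᵖ (exact_mulLeft hfa hk) hf z).1 hz
  exact ⟨x, by rw [tmul_one_mul, hx]⟩

theorem rTensor_tmul_one_mul (z : A ⊗[K] Aᵐᵒᵖ) :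
    LinearMap.rTensor Aᵐᵒᵖ f.toLinearMap ((a ⊗ₜ[K] (1 : Aᵐᵒᵖ)) * z) = 0 := by
  rw [tmul_one_mul]
  exact (rTensor_exact Aᵐᵒᵖ (exact_mulLeft hfa hk) hf _).2 ⟨z, rfl⟩

include ha in
/-- The kernel of the homomorphism of enveloping algebras induced by the quotient by a central
element `a` is generated by `a ⊗ 1` and `1 ⊗ a`. -/
theorem exists_of_envelopingMap_eq_zero {z : A ⊗[K] Aᵐᵒᵖ} (hz : envelopingMap f z = 0) :
    ∃ x y, z = (a ⊗ₜ[K] (1 : Aᵐᵒᵖ)) * x + ((1 : A) ⊗ₜ[K] MulOpposite.op a) * y := by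
  have h1 : LinearMap.lTensor B (AlgHom.op f).toLinearMap
      (LinearMap.rTensor Aᵐᵒᵖ f.toLinearMap z) = 0 := by
    rw [← LinearMap.comp_apply, LinearMap.lTensor_comp_rTensor]
    exact hz
  have hop : Function.Surjective (AlgHom.op f) := fun b => by
    obtain ⟨a, ha⟩ := hf b.unop
    exact ⟨MulOpposite.op a, congrArg MulOpposite.op ha⟩
  obtain ⟨y', hy'⟩ := (lTensor_exact B (exact_mulLeft_op ha hfa hk) hop _).1 h1
  -- The kernel is computed one tensor factor at a time: after `f ⊗ id`, the image of `z` is a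
  -- multiple of `1 ⊗ a`. Subtracting a lift of that multiple leaves an element killed by `f ⊗ id`,
  -- hence a multiple of `a ⊗ 1`.
  obtain ⟨y, rfl⟩ := LinearMap.rTensor_surjective Aᵐᵒᵖ (g := f.toLinearMap) hf y'
  obtain ⟨x, hx⟩ := exists_of_rTensor_eq_zero hf hfa hk
    (z := z - ((1 : A) ⊗ₜ[K] MulOpposite.op a) * y) (by
      rw [map_sub, ← hy', one_tmul_mul, ← LinearMap.comp_apply, ← LinearMap.comp_apply,
        LinearMap.rTensor_comp_lTensor, LinearMap.lTensor_comp_rTensor, sub_self])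
  exact ⟨x, y, by rw [← hx, sub_add_cancel]⟩

variable (hreg : ∀ x, a * x = 0 → x = 0)

omit hf hfa hk in
include hreg in
-- Tensoring over a field preserves the injectivity of multiplication by `a`.
theorem tmul_one_regular {z : A ⊗[K] Aᵐᵒᵖ} (hz : (a ⊗ₜ[K] (1 : Aᵐᵒᵖ)) * z = 0) : z = 0 := by
  have hinj : Function.Injective (LinearMap.mulLeft K a) :=
    (injective_iff_map_eq_zero _).2 hreg
  rw [tmul_one_mul] at hz
  exact Module.Flat.rTensor_preserves_injective_linearMap (M := Aᵐᵒᵖ) _ hinj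
    (hz.trans (map_zero _).symm)

include ha hreg in
/-- If `(a ⊗ 1) z = (a ⊗ 1 - 1 ⊗ a) w`, then `w` is a multiple of `a ⊗ 1`. -/
theorem exists_of_tmul_one_mul_eq {z w : A ⊗[K] Aᵐᵒᵖ}
    (h : (a ⊗ₜ[K] (1 : Aᵐᵒᵖ)) * z =
      (a ⊗ₜ[K] (1 : Aᵐᵒᵖ) - (1 : A) ⊗ₜ[K] MulOpposite.op a) * w) :
    ∃ w', w = (a ⊗ₜ[K] (1 : Aᵐᵒᵖ)) * w' := by
  refine exists_of_rTensor_eq_zero hf hfa hk ?_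
  -- Under `f ⊗ id` all multiples of `a ⊗ 1` vanish, so `1 ⊗ a` annihilates the image of `w`.
  -- Multiplication by `1 ⊗ a` is injective on `B ⊗ Aᵐᵒᵖ`, again by flatness.
  have h1 := congrArg (LinearMap.rTensor Aᵐᵒᵖ f.toLinearMap) h
  rw [sub_mul, map_sub, rTensor_tmul_one_mul hf hfa hk, rTensor_tmul_one_mul hf hfa hk,
    zero_sub, eq_comm, neg_eq_zero, one_tmul_mul, ← LinearMap.comp_apply,
    LinearMap.rTensor_comp_lTensor, ← LinearMap.lTensor_comp_rTensor, LinearMap.comp_apply] at h1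
  have hinj : Function.Injective (LinearMap.mulLeft K (MulOpposite.op a)) :=
    (injective_iff_map_eq_zero _).2 fun x hx => MulOpposite.unop_injective <| hreg _ <| by
      rw [ha]
      exact congrArg MulOpposite.unop hx
  exact Module.Flat.lTensor_preserves_injective_linearMap (M := B) _ hinj
    (h1.trans (map_zero _).symm)

end CentralKernel

end Enveloping

/-- Each component of `x` is `c` times a component of strictly smaller degree, and these vanish in
low degrees. This is how `t - 1` is seen to act injectively on graded modules that are bounded
below. -/
theorem GradedMod.eq_zero_of_smul_eq_self {G : Type v} [AddCommGroup G] [DecidableEq G]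
    {K : Type w} [Field K] {A : Type u} [Ring A] [Algebra K A] {𝒜 : G → Submodule K A}
    {M : GradedMod 𝒜} {δ : G →+ ℤ} (hM : M.IsBoundedBelow δ) {c : A} {d : G} (hc : c ∈ 𝒜 d)
    (hd : 0 < δ d) {x : M.carrier} (hx : c • x = x) : x = 0 := by
  obtain ⟨m, hm⟩ := hM
  have key : ∀ (k : ℕ) (g : G), δ g < m + k → M.proj g x = 0 := by
    intro k
    induction k with
    | zero =>
      intro g hg
      have h := M.isInternal.proj_mem g x
      rw [hm g (by simpa using hg)] at h
      exact h
    | succ k ih =>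
      intro g hg
      have h := M.proj_smul hc (g - d) x
      rw [add_sub_cancel, hx] at h
      rw [h, ih, smul_zero]
      rw [map_sub]
      push_cast at hg
      omega
  exact M.isInternal.eq_zero_of_proj fun g => key (δ g - m + 1).toNat g (by omega)

set_option linter.unusedSectionVars false

/-! ### The relative enveloping algebra Λ and the regularity of `t ⊗ 1 - 1 ⊗ t`. -/

namespace GradedReduction

variable {G : Type v} [AddCommGroup G] [DecidableEq G] {K : Type w} [Field K]
  {R : Type u} [Ring R] [Algebra K R] {S : Type u} [Ring S] [Algebra K S]
  {ℛ : G → Submodule K R} {𝒮 : G → Submodule K S} [GradedAlgebra ℛ] (D : GradedReduction ℛ 𝒮)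

/-- The element `t ⊗ 1` of the enveloping algebra of the Rees algebra. -/
noncomputable def tLeft : R ⊗[K] Rᵐᵒᵖ := D.c ⊗ₜ 1

/-- The element `t ⊗ 1 - 1 ⊗ t` of the enveloping algebra of the Rees algebra. -/
noncomputable def tDiff : R ⊗[K] Rᵐᵒᵖ :=
  D.c ⊗ₜ 1 - 1 ⊗ₜ MulOpposite.op D.c

theorem tLeft_mem : D.tLeft ∈ envelopingGrading ℛ D.d := by
  have h := tmul_mem_envelopingGrading D.c_mem (SetLike.one_mem_graded ℛ)
  rwa [add_zero] at h

theorem tDiff_mem : D.tDiff ∈ envelopingGrading ℛ D.d := by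
  have h := tmul_mem_envelopingGrading (SetLike.one_mem_graded ℛ) D.c_mem
  rw [zero_add] at h
  exact sub_mem D.tLeft_mem h

theorem tLeft_comm (z : R ⊗[K] Rᵐᵒᵖ) : D.tLeft * z = z * D.tLeft :=
  tmul_one_comm D.comm z

theorem tDiff_comm (z : R ⊗[K] Rᵐᵒᵖ) : D.tDiff * z = z * D.tDiff := by
  rw [tDiff, sub_mul, mul_sub, tmul_one_comm D.comm, one_tmul_comm D.comm]

theorem tLeft_regular {z : R ⊗[K] Rᵐᵒᵖ} (hz : D.tLeft * z = 0) : z = 0 :=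
  tmul_one_regular D.regular hz

theorem exists_of_tLeft_mul_eq {z w : R ⊗[K] Rᵐᵒᵖ} (h : D.tLeft * z = D.tDiff * w) :
    ∃ w', w = D.tLeft * w' :=
  exists_of_tmul_one_mul_eq D.surjective D.comm D.φ_c
    D.exists_of_φ_eq_zero D.regular h

omit [DecidableEq G] [GradedAlgebra ℛ] in
theorem _root_.envelopingGrading_eq_bot {δ : G →+ ℤ} (hδ : ∀ g, δ g < 0 → ℛ g = ⊥) (i : G)
    (hi : δ i < 0) : envelopingGrading ℛ i = ⊥ := by
  rw [eq_bot_iff]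
  refine Submodule.span_le.2 ?_
  rintro _ ⟨j, k, rfl, a, ha, b, hb, rfl⟩
  have h : δ j < 0 ∨ δ k < 0 := by
    rw [map_add] at hi
    omega
  rcases h with h | h
  · rw [hδ _ h, Submodule.mem_bot] at ha
    rw [ha, TensorProduct.zero_tmul]
    exact zero_mem _
  · rw [hδ _ h, Submodule.mem_bot] at hb
    rw [hb, MulOpposite.op_zero, TensorProduct.tmul_zero]
    exact zero_mem _

/-- An element killed by `t ⊗ 1 - 1 ⊗ t` is a multiple of `t ⊗ 1`; cancelling this regular factor
leaves another such element. So it is divisible by all powers of `t ⊗ 1`, which the degree bound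
excludes for nonzero homogeneous elements. -/
theorem tDiff_regular {δ : G →+ ℤ} (hδ : ∀ g, δ g < 0 → ℛ g = ⊥) (hd : 0 < δ D.d)
    (z : R ⊗[K] Rᵐᵒᵖ) (hz : D.tDiff * z = 0) :
    z = 0 := by
  have key : ∀ (k : ℕ) (z : R ⊗[K] Rᵐᵒᵖ), D.tDiff * z = 0 →
      ∃ y, z = D.tLeft ^ k * y := by
    intro k
    induction k with
    | zero => exact fun z _ => ⟨z, by rw [pow_zero, one_mul]⟩
    | succ k ih =>
      intro z hz
      obtain ⟨y, rfl⟩ := D.exists_of_tLeft_mul_eq (z := 0) (w := z) (by rw [hz, mul_zero])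
      rw [← mul_assoc, ← D.tLeft_comm, mul_assoc] at hz
      obtain ⟨x, rfl⟩ := ih y (D.tLeft_regular hz)
      exact ⟨x, by rw [pow_succ', mul_assoc]⟩
  have hg : ∀ g, (DirectSum.decompose (envelopingGrading ℛ) z g :
      R ⊗[K] Rᵐᵒᵖ) = 0 := by
    intro g
    have h1 := DirectSum.coe_decompose_mul_add_of_left_mem (envelopingGrading ℛ)
      (j := g) (b := z) D.tDiff_mem
    rw [hz, DirectSum.decompose_zero, DirectSum.zero_apply, ZeroMemClass.coe_zero] at h1
    obtain ⟨y, hy⟩ := key (δ g + 1).toNat _ h1.symm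
    refine GradedAlgebra.eq_zero_of_mem_pow_mul δ (envelopingGrading_eq_bot hδ) D.tLeft_mem
      (SetLike.coe_mem _) hy ?_
    nlinarith [Int.self_le_toNat (δ g + 1), Int.natCast_nonneg (δ g + 1).toNat]
  classical
  rw [← DirectSum.sum_support_decompose (envelopingGrading ℛ) z]
  exact Finset.sum_eq_zero fun g _ => hg g

/-- The ideal generated by the central element `t ⊗ 1 - 1 ⊗ t`. -/
noncomputable def tDiffIdeal : Ideal (R ⊗[K] Rᵐᵒᵖ) := Ideal.span {D.tDiff}

instance : D.tDiffIdeal.IsTwoSided where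
  mul_mem_of_left := by
    intro a b ha
    obtain ⟨c, rfl⟩ := Ideal.mem_span_singleton'.1 ha
    refine Ideal.mem_span_singleton'.2 ⟨c * b, ?_⟩
    rw [mul_assoc, mul_assoc, D.tDiff_comm]

/-- The enveloping algebra of the Rees algebra over the polynomial ring in `t`. -/
abbrev relEnveloping : Type u := (R ⊗[K] Rᵐᵒᵖ) ⧸ D.tDiffIdeal

/-- The quotient map from the enveloping algebra to the relative one. -/
noncomputable def relEnvelopingMk : R ⊗[K] Rᵐᵒᵖ →ₐ[K] D.relEnveloping :=
  Ideal.Quotient.mkₐ K D.tDiffIdeal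

theorem relEnvelopingMk_surjective : Function.Surjective D.relEnvelopingMk :=
  Ideal.Quotient.mk_surjective

theorem relEnvelopingMk_eq_zero_iff (z : R ⊗[K] Rᵐᵒᵖ) :
    D.relEnvelopingMk z = 0 ↔ ∃ y, z = D.tDiff * y := by
  refine Ideal.Quotient.eq_zero_iff_mem.trans (Ideal.mem_span_singleton'.trans ?_)
  exact exists_congr fun y => by rw [D.tDiff_comm, eq_comm]

/-- The grading of the relative enveloping algebra. -/
noncomputable def relEnvelopingGrading (i : G) : Submodule K D.relEnveloping :=
  (envelopingGrading ℛ i).map D.relEnvelopingMk.toLinearMap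

noncomputable instance : GradedAlgebra D.relEnvelopingGrading :=
  (GradedAlgebra.nonempty_map (envelopingGrading ℛ) D.relEnvelopingMk
    D.relEnvelopingMk_surjective (by
      intro z hz g
      obtain ⟨y, rfl⟩ := (D.relEnvelopingMk_eq_zero_iff z).1 hz
      have h1 := DirectSum.coe_decompose_mul_add_of_left_mem (envelopingGrading ℛ)
        (j := g - D.d) (b := y) D.tDiff_mem
      rw [add_sub_cancel] at h1
      rw [h1]
      exact (D.relEnvelopingMk_eq_zero_iff _).2 ⟨_, rfl⟩)).some

theorem relEnvelopingGrading_eq_bot {δ : G →+ ℤ} (hδ : ∀ g, δ g < 0 → ℛ g = ⊥) (i : G)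
    (hi : δ i < 0) : D.relEnvelopingGrading i = ⊥ := by
  rw [relEnvelopingGrading, envelopingGrading_eq_bot hδ i hi, Submodule.map_bot]

/-- The relative enveloping algebra as the quotient of the enveloping algebra by
`t ⊗ 1 - 1 ⊗ t`. -/
noncomputable def relReduction {δ : G →+ ℤ} (hδ : ∀ g, δ g < 0 → ℛ g = ⊥) (hd : 0 < δ D.d) :
    GradedReduction (envelopingGrading ℛ) D.relEnvelopingGrading where
  φ := D.relEnvelopingMk
  surjective := D.relEnvelopingMk_surjective
  c := D.tDiff
  d := D.d
  c_mem := D.tDiff_mem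
  comm := D.tDiff_comm
  regular := D.tDiff_regular hδ hd
  φ_c := (D.relEnvelopingMk_eq_zero_iff _).2 ⟨1, (mul_one _).symm⟩
  exists_of_φ_eq_zero z := (D.relEnvelopingMk_eq_zero_iff z).1
  map_eq _ := rfl

section Descent

variable {B : Type u} [Ring B] [Algebra K B] (f : R →ₐ[K] B)

/-- The homomorphism from the relative enveloping algebra that is induced by a homomorphism from
the Rees algebra which maps `t` to a central element. -/
noncomputable def relEnvelopingLift (k : K) (hf : f D.c = algebraMap K B k) :
    D.relEnveloping →ₐ[K] B ⊗[K] Bᵐᵒᵖ :=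
  Ideal.Quotient.liftₐ D.tDiffIdeal (envelopingMap f) (by
    intro z hz
    obtain ⟨y, rfl⟩ := Ideal.mem_span_singleton'.1 hz
    rw [map_mul, tDiff, map_sub, ← MulOpposite.op_one, envelopingMap_tmul, envelopingMap_tmul, hf,
      map_one, Algebra.algebraMap_eq_smul_one, MulOpposite.op_smul, TensorProduct.tmul_smul,
      TensorProduct.smul_tmul', sub_self, mul_zero])

variable {f} {k : K} (hf : f D.c = algebraMap K B k)

theorem relEnvelopingLift_mk (z : R ⊗[K] Rᵐᵒᵖ) :
    D.relEnvelopingLift f k hf (D.relEnvelopingMk z) = envelopingMap f z := rfl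

theorem relEnvelopingLift_surjective (hs : Function.Surjective f) :
    Function.Surjective (D.relEnvelopingLift f k hf) := fun y => by
  obtain ⟨z, rfl⟩ := envelopingMap_surjective hs y
  exact ⟨D.relEnvelopingMk z, rfl⟩

/-- The central element of the relative enveloping algebra given by `t - k`. -/
noncomputable def relT (k : K) : D.relEnveloping :=
  D.relEnvelopingMk (D.tLeft - algebraMap K _ k)

theorem relT_comm (k : K) (s : D.relEnveloping) : D.relT k * s = s * D.relT k := by
  obtain ⟨z, rfl⟩ := D.relEnvelopingMk_surjective s
  rw [relT, ← map_mul, ← map_mul, sub_mul, mul_sub, D.tLeft_comm, Algebra.commutes]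

theorem relEnvelopingLift_relT : D.relEnvelopingLift f k hf (D.relT k) = 0 := by
  rw [relT, relEnvelopingLift_mk, map_sub, AlgHom.commutes, tLeft, ← MulOpposite.op_one,
    envelopingMap_tmul, hf, map_one, MulOpposite.op_one, Algebra.TensorProduct.algebraMap_apply,
    sub_self]

/-- In the enveloping algebra the kernel needs the two generators `(t - k) ⊗ 1` and `1 ⊗ (t - k)`;
their difference is `t ⊗ 1 - 1 ⊗ t`, so they become one element of Λ. -/
theorem exists_of_relEnvelopingLift_eq_zero (hs : Function.Surjective f)
    (hk : ∀ p, f p = 0 → ∃ q, p = (D.c - algebraMap K _ k) * q) (s : D.relEnveloping)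
    (h : D.relEnvelopingLift f k hf s = 0) : ∃ s', s = D.relT k * s' := by
  obtain ⟨z, rfl⟩ := D.relEnvelopingMk_surjective s
  obtain ⟨x, y, rfl⟩ := exists_of_envelopingMap_eq_zero hs
    (a := D.c - algebraMap K _ k)
    (fun p => by rw [sub_mul, mul_sub, D.comm, Algebra.commutes])
    (by rw [map_sub, hf, AlgHom.commutes, sub_self]) hk h
  have h1 : (D.c - algebraMap K _ k) ⊗ₜ[K] (1 : Rᵐᵒᵖ) =
      D.tLeft - algebraMap K _ k := by
    rw [TensorProduct.sub_tmul, Algebra.TensorProduct.algebraMap_apply]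
    rfl
  have h2 : (1 : R) ⊗ₜ[K] MulOpposite.op (D.c - algebraMap K _ k) =
      D.tLeft - algebraMap K _ k - D.tDiff := by
    rw [MulOpposite.op_sub, TensorProduct.tmul_sub, Algebra.TensorProduct.algebraMap_apply',
      tLeft, tDiff]
    change _ - _ ⊗ₜ[K] algebraMap K Rᵐᵒᵖ k = _
    abel
  have h3 : D.relEnvelopingMk D.tDiff = 0 :=
    (D.relEnvelopingMk_eq_zero_iff _).2 ⟨1, (mul_one _).symm⟩
  refine ⟨D.relEnvelopingMk (x + y), ?_⟩
  rw [h1, h2, map_add, map_mul, map_mul, map_sub _ _ D.tDiff, h3, sub_zero, ← mul_add, ← map_add]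
  rfl

end Descent

end GradedReduction

/-! ### Specialisations of Λ at `t = 0` and `t = 1`, and the regular bimodule. -/

namespace GradedReduction

section

variable {G : Type v} [AddCommGroup G] [DecidableEq G] {K : Type w} [Field K]
  {S : Type u} [Ring S] [Algebra K S] {T : Type u} [Ring T] [Algebra K T]
  {𝒮 : G → Submodule K S} {𝒯 : G → Submodule K T}

/-- A reduction of a graded module that is given by a semilinear map on an isomorphic module. -/
noncomputable def reductionOfBijective (D : GradedReduction 𝒮 𝒯) {N : GradedMod 𝒮}
    {X : GradedMod 𝒯} {E M : Type*} [Ring E] [AddCommGroup M] [Module E M] (θ : E →+* S)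
    (hθ : Function.Surjective θ) (q : M →+ N.carrier) (hq : Function.Bijective q)
    (hqs : ∀ e x, q (e • x) = θ e • q x) (f : M →+ X.carrier) (hf : Function.Surjective f)
    (hfs : ∀ e x, f (e • x) = D.φ (θ e) • f x) (e₀ : E) (he₀ : θ e₀ = D.c)
    (hk : ∀ x, f x = 0 → ∃ y, x = e₀ • y)
    (hm : ∀ g x, q x ∈ N.piece g → f x ∈ X.piece g) : D.Reduction N X :=
  have key : ∀ x, (AddEquiv.ofBijective q hq).symm (q x) = x :=
    (AddEquiv.ofBijective q hq).symm_apply_apply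
  { π := f.comp (AddEquiv.ofBijective q hq).symm.toAddMonoidHom
    map_smul := by
      intro s y
      obtain ⟨e, rfl⟩ := hθ s
      obtain ⟨x, rfl⟩ := hq.2 y
      change f ((AddEquiv.ofBijective q hq).symm _) = _ • f ((AddEquiv.ofBijective q hq).symm _)
      rw [← hqs, key, key, hfs]
    surjective := hf.comp (AddEquiv.ofBijective q hq).symm.surjective
    exists_of_π_eq_zero := by
      intro y hy
      obtain ⟨x, rfl⟩ := hq.2 y
      replace hy : f ((AddEquiv.ofBijective q hq).symm (q x)) = 0 := hy
      rw [key] at hy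
      obtain ⟨z, rfl⟩ := hk x hy
      exact ⟨q z, by rw [hqs, he₀]⟩
    π_mem := by
      intro g y hy
      obtain ⟨x, rfl⟩ := hq.2 y
      change f ((AddEquiv.ofBijective q hq).symm (q x)) ∈ _
      rw [key]
      exact hm g x hy }

end

variable {G : Type v} [AddCommGroup G] [DecidableEq G] {K : Type w} [Field K]
  {R : Type u} [Ring R] [Algebra K R] {S : Type u} [Ring S] [Algebra K S]
  {ℛ : G → Submodule K R} {𝒮 : G → Submodule K S} [GradedAlgebra ℛ] (D : GradedReduction ℛ 𝒮)

theorem relEnvelopingMk_mem {g : G} {z : R ⊗[K] Rᵐᵒᵖ} (hz : z ∈ envelopingGrading ℛ g) :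
    D.relEnvelopingMk z ∈ D.relEnvelopingGrading g := ⟨z, hz, rfl⟩

/-- In effect `t ⊗ 1` and `t ⊗ 1 - 1 ⊗ t` form a regular sequence in either order: from `(t ⊗ 1) z =
(t ⊗ 1 - 1 ⊗ t) w` it follows that `w` is divisible by `t ⊗ 1`, which can then be cancelled. -/
theorem relT_regular_zero (s : D.relEnveloping) (h : D.relT 0 * s = 0) : s = 0 := by
  obtain ⟨z, rfl⟩ := D.relEnvelopingMk_surjective s
  rw [relT, map_zero, sub_zero, ← map_mul] at h
  obtain ⟨w, hw⟩ := (D.relEnvelopingMk_eq_zero_iff _).1 h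
  obtain ⟨w', rfl⟩ := D.exists_of_tLeft_mul_eq hw
  refine (D.relEnvelopingMk_eq_zero_iff _).2 ⟨w', ?_⟩
  rw [← sub_eq_zero]
  apply D.tLeft_regular
  rw [mul_sub, hw, ← mul_assoc, ← mul_assoc, D.tLeft_comm, sub_self]

theorem relT_one : D.relT 1 = D.relEnvelopingMk D.tLeft - 1 := by
  rw [relT, map_one, map_sub, map_one]

theorem relT_regular_one {δ : G →+ ℤ} (hδ : ∀ g, δ g < 0 → ℛ g = ⊥) (hd : 0 < δ D.d)
    (s : D.relEnveloping) (h : D.relT 1 * s = 0) : s = 0 := by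
  -- Λ is viewed as the free graded module of rank one, on which `t s = s` forces `s = 0`.
  have hb : (GradedMod.free D.relEnvelopingGrading fun _ : Fin 1 => 0).IsBoundedBelow δ := by
    refine ⟨0, fun g hg => eq_bot_iff.2 fun x hx => funext fun i => ?_⟩
    have h1 := hx i trivial
    change x i ∈ D.relEnvelopingGrading (g - 0) at h1
    rw [sub_zero, D.relEnvelopingGrading_eq_bot hδ g hg] at h1
    exact h1
  rw [relT_one, sub_mul, one_mul, sub_eq_zero] at h
  exact congrFun (GradedMod.eq_zero_of_smul_eq_self hb (D.relEnvelopingMk_mem D.tLeft_mem) hd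
    (x := (fun _ : Fin 1 => s)) (funext fun _ => h)) 0

theorem φ_c_eq_algebraMap : D.φ D.c = algebraMap K S 0 := by rw [D.φ_c, map_zero]

/-- The enveloping algebra of the quotient by `t` as the quotient of the relative enveloping
algebra by `t`. -/
noncomputable def specialReduction :
    GradedReduction D.relEnvelopingGrading (envelopingGrading 𝒮) where
  φ := D.relEnvelopingLift D.φ 0 D.φ_c_eq_algebraMap
  surjective := D.relEnvelopingLift_surjective _ D.surjective
  c := D.relT 0
  d := D.d
  c_mem := by
    rw [relT, map_zero, sub_zero]
    exact D.relEnvelopingMk_mem D.tLeft_mem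
  comm := D.relT_comm 0
  regular := D.relT_regular_zero
  φ_c := D.relEnvelopingLift_relT _
  exists_of_φ_eq_zero := D.exists_of_relEnvelopingLift_eq_zero _ D.surjective fun p hp => by
    rw [map_zero, sub_zero]
    exact D.exists_of_φ_eq_zero p hp
  map_eq g := by
    refine le_antisymm ?_ (Submodule.span_le.2 ?_)
    · rintro _ ⟨_, ⟨z, hz, rfl⟩, rfl⟩
      exact envelopingMap_mem (AddMonoidHom.id G) (fun i a ha => D.φ_mem ha) hz
    · rintro _ ⟨i, j, rfl, a, ha, b, hb, rfl⟩
      obtain ⟨a, ha', rfl⟩ := D.exists_mem ha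
      obtain ⟨b, hb', rfl⟩ := D.exists_mem hb
      exact ⟨_, D.relEnvelopingMk_mem (tmul_mem_envelopingGrading ha' hb'), rfl⟩

section Generic

variable {H : Type v} [AddCommGroup H] [DecidableEq H] {B : Type u} [Ring B] [Algebra K B]
  {ℬ : H → Submodule K B} {f : R →ₐ[K] B}

/-- The enveloping algebra of the quotient by `t - 1` as the quotient of the relative enveloping
algebra by `t - 1`. -/
noncomputable def genericReduction {δ : G →+ ℤ} (hδ : ∀ g, δ g < 0 → ℛ g = ⊥) (hd : 0 < δ D.d)
    (γ : G →+ H) (hγ : γ D.d = 0) (hf : Function.Surjective f)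
    (hfc : f D.c = algebraMap K B 1) (hfk : ∀ p, f p = 0 → ∃ q, p = (D.c - 1) * q)
    (hfm : ∀ i, ∀ a ∈ ℛ i, f a ∈ ℬ (γ i))
    (hfm' : ∀ h, ∀ b ∈ ℬ h, ∃ i, γ i = h ∧ ∃ a ∈ ℛ i, f a = b) :
    GradedReduction (coarseGrading γ D.relEnvelopingGrading) (envelopingGrading ℬ) where
  φ := D.relEnvelopingLift f 1 hfc
  surjective := D.relEnvelopingLift_surjective _ hf
  c := D.relT 1
  -- The element `t - 1` is homogeneous only after coarsening along `γ`, which sends the degree of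
  -- `t` to zero.
  d := 0
  c_mem := by
    rw [relT_one]
    refine sub_mem (Submodule.mem_iSup_of_mem ⟨D.d, hγ⟩ (D.relEnvelopingMk_mem D.tLeft_mem))
      (Submodule.mem_iSup_of_mem ⟨0, map_zero γ⟩ (SetLike.one_mem_graded D.relEnvelopingGrading))
  comm := D.relT_comm 1
  regular := D.relT_regular_one hδ hd
  φ_c := D.relEnvelopingLift_relT _
  exists_of_φ_eq_zero := D.exists_of_relEnvelopingLift_eq_zero _ hf fun p hp => by
    rw [map_one]
    exact hfk p hp
  map_eq h := by
    refine le_antisymm ?_ (Submodule.span_le.2 ?_)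
    · rw [coarseGrading, Submodule.map_iSup]
      refine iSup_le ?_
      rintro ⟨i, rfl⟩ _ ⟨_, ⟨z, hz, rfl⟩, rfl⟩
      exact envelopingMap_mem γ hfm hz
    · rintro _ ⟨i, j, rfl, a, ha, b, hb, rfl⟩
      obtain ⟨i', rfl, a, ha', rfl⟩ := hfm' _ _ ha
      obtain ⟨j', rfl, b, hb', rfl⟩ := hfm' _ _ hb
      exact ⟨_, Submodule.mem_iSup_of_mem (⟨i' + j', map_add γ _ _⟩ : {i // γ i = γ i' + γ j'})
        (D.relEnvelopingMk_mem (tmul_mem_envelopingGrading ha' hb')), rfl⟩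

end Generic

section RegularBimodule

/-- The identification of a graded algebra with its regular bimodule. -/
def toBimodule (ℛ : G → Submodule K R) [GradedAlgebra ℛ] :
    R ≃+ (GradedMod.regularBimodule ℛ).carrier := AddEquiv.refl R

theorem tmul_smul_toBimodule (a b x : R) :
    (a ⊗ₜ[K] MulOpposite.op b) • toBimodule ℛ x = toBimodule ℛ (a * (x * b)) := rfl

theorem tLeft_smul (x : R) : D.tLeft • toBimodule ℛ x = toBimodule ℛ (D.c * x) := by
  rw [tLeft, ← MulOpposite.op_one, tmul_smul_toBimodule, mul_one]

theorem tDiff_smul (x : (GradedMod.regularBimodule ℛ).carrier) : D.tDiff • x = 0 := by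
  obtain ⟨x, rfl⟩ := (toBimodule ℛ).surjective x
  rw [tDiff, sub_smul, sub_eq_zero, ← MulOpposite.op_one, tmul_smul_toBimodule,
    tmul_smul_toBimodule, mul_one, one_mul, D.comm]

variable {H : Type v} [AddCommGroup H] [DecidableEq H] {B : Type u}
    [Ring B] [Algebra K B] {ℬ : H → Submodule K B} [GradedAlgebra ℬ]

/-- A homomorphism of algebras as an additive map of regular bimodules. -/
def bimoduleMap (ℛ : G → Submodule K R) [GradedAlgebra ℛ] (ℬ : H → Submodule K B)
    [GradedAlgebra ℬ] (f : R →ₐ[K] B) :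
    (GradedMod.regularBimodule ℛ).carrier →+ (GradedMod.regularBimodule ℬ).carrier :=
  (f : R →+ B)

theorem bimoduleMap_toBimodule (f : R →ₐ[K] B) (x : R) :
    bimoduleMap ℛ ℬ f (toBimodule ℛ x) = toBimodule ℬ (f x) := rfl

theorem bimoduleMap_smul (f : R →ₐ[K] B)
    (z : R ⊗[K] Rᵐᵒᵖ) (x : (GradedMod.regularBimodule ℛ).carrier) :
    bimoduleMap ℛ ℬ f (z • x) = envelopingMap f z • bimoduleMap ℛ ℬ f x := by
  induction z using TensorProduct.induction_on with
  | zero =>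
    rw [map_zero (envelopingMap f)]
    exact ((congrArg _ (zero_smul (R ⊗[K] Rᵐᵒᵖ) x)).trans (map_zero _)).trans
      (zero_smul (B ⊗[K] Bᵐᵒᵖ) (bimoduleMap ℛ ℬ f x)).symm
  | add z w hz hw => rw [add_smul, map_add, hz, hw, map_add, add_smul]
  | tmul a b =>
    obtain ⟨x, rfl⟩ := (toBimodule ℛ).surjective x
    obtain ⟨b, rfl⟩ := MulOpposite.op_surjective b
    rw [tmul_smul_toBimodule, envelopingMap_tmul, bimoduleMap_toBimodule, bimoduleMap_toBimodule,
      tmul_smul_toBimodule, map_mul f, map_mul f]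

theorem exists_of_bimoduleMap_eq_zero {f : R →ₐ[K] B} {k : K}
    (hk : ∀ p, f p = 0 → ∃ q, p = (D.c - algebraMap K R k) * q)
    (x : (GradedMod.regularBimodule ℛ).carrier) (hx : bimoduleMap ℛ ℬ f x = 0) :
    ∃ y, x = (D.tLeft - algebraMap K (R ⊗[K] Rᵐᵒᵖ) k) • y := by
  obtain ⟨x, rfl⟩ := (toBimodule ℛ).surjective x
  obtain ⟨q, rfl⟩ := hk x hx
  refine ⟨toBimodule ℛ q, ?_⟩
  rw [sub_smul, tLeft_smul, Algebra.TensorProduct.algebraMap_apply, ← MulOpposite.op_one,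
    tmul_smul_toBimodule, mul_one, ← map_sub, sub_mul]

variable {δ : G →+ ℤ} (hδ : ∀ g, δ g < 0 → ℛ g = ⊥) (hd : 0 < δ D.d)

/-- The graded algebra as a graded module over its relative enveloping algebra. -/
noncomputable def relBimodule : GradedMod D.relEnvelopingGrading :=
  (D.relReduction hδ hd).reduce (GradedMod.regularBimodule ℛ)

/-- The identification of the regular bimodule with the module over the relative enveloping
algebra. -/
noncomputable def toRelBimodule :
    (D.relReduction hδ hd).Reduction (GradedMod.regularBimodule ℛ) (D.relBimodule hδ hd) :=
  (D.relReduction hδ hd).toReduce _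

/-- `t ⊗ 1 - 1 ⊗ t` acts as zero on `R` because `t` is central, so forming the quotient only changes
the ring of scalars. -/
theorem toRelBimodule_bijective : Function.Bijective (D.toRelBimodule hδ hd).π := by
  refine ⟨(injective_iff_map_eq_zero _).2 fun x hx => ?_, (D.toRelBimodule hδ hd).surjective⟩
  obtain ⟨y, rfl⟩ := (D.toRelBimodule hδ hd).exists_of_π_eq_zero x hx
  exact D.tDiff_smul y

theorem toRelBimodule_smul (z : R ⊗[K] Rᵐᵒᵖ) (x : (GradedMod.regularBimodule ℛ).carrier) :
    (D.toRelBimodule hδ hd).π (z • x) = D.relEnvelopingMk z • (D.toRelBimodule hδ hd).π x :=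
  (D.toRelBimodule hδ hd).map_smul z x

theorem mem_of_toRelBimodule_mem {g : G} {x : (GradedMod.regularBimodule ℛ).carrier}
    (h : (D.toRelBimodule hδ hd).π x ∈ (D.relBimodule hδ hd).piece g) :
    x ∈ (GradedMod.regularBimodule ℛ).piece g :=
  (D.toRelBimodule hδ hd).hom.mem_of_map_mem (D.toRelBimodule_bijective hδ hd).1 h

theorem relBimodule_isBoundedBelow : (D.relBimodule hδ hd).IsBoundedBelow δ := by
  refine ⟨0, fun g hg => eq_bot_iff.2 fun y hy => ?_⟩
  obtain ⟨x, hx, rfl⟩ := (D.toRelBimodule hδ hd).π_mem_iff_exists hy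
  have h1 : x = 0 := (hδ g hg).le hx
  rw [h1, map_zero]
  exact zero_mem _

theorem relT_zero_smul {y : (D.relBimodule hδ hd).carrier} (hy : D.relT 0 • y = 0) : y = 0 := by
  obtain ⟨x, rfl⟩ := (D.toRelBimodule hδ hd).surjective y
  obtain ⟨x, rfl⟩ := (toBimodule ℛ).surjective x
  rw [relT, map_zero, sub_zero, ← toRelBimodule_smul, tLeft_smul] at hy
  have h1 : toBimodule ℛ (D.c * x) = 0 :=
    (D.toRelBimodule_bijective hδ hd).1 (hy.trans (map_zero _).symm)
  rw [D.regular x ((toBimodule ℛ).injective (h1.trans (map_zero _).symm)), map_zero, map_zero]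

theorem relT_one_smul {y : (D.relBimodule hδ hd).carrier} (hy : D.relT 1 • y = 0) : y = 0 := by
  rw [relT_one, sub_smul, one_smul, sub_eq_zero] at hy
  exact GradedMod.eq_zero_of_smul_eq_self (D.relBimodule_isBoundedBelow hδ hd)
    (D.relEnvelopingMk_mem D.tLeft_mem) hd hy

theorem hasFiniteResolution_relBimodule [GradedAlgebra 𝒮] {n : ℕ}
    (h : (GradedMod.regularBimodule 𝒮).HasFiniteResolution n) :
    (D.relBimodule hδ hd).HasFiniteResolution n := by
  let r : D.specialReduction.Reduction (D.relBimodule hδ hd) (GradedMod.regularBimodule 𝒮) :=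
    D.specialReduction.reductionOfBijective (D.relEnvelopingMk : R ⊗[K] Rᵐᵒᵖ →+* D.relEnveloping)
      D.relEnvelopingMk_surjective (D.toRelBimodule hδ hd).π (D.toRelBimodule_bijective hδ hd)
      (D.toRelBimodule_smul hδ hd) (bimoduleMap ℛ 𝒮 D.φ) D.surjective (bimoduleMap_smul D.φ)
      (D.tLeft - algebraMap K _ 0) rfl
      (D.exists_of_bimoduleMap_eq_zero fun p hp => by
        rw [map_zero, sub_zero]
        exact D.exists_of_φ_eq_zero p hp)
      fun g x hx => D.φ_mem (D.mem_of_toRelBimodule_mem hδ hd hx)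
  exact hasFiniteResolution_of_reduction (D.relEnvelopingGrading_eq_bot hδ) hd r
    (D.relBimodule_isBoundedBelow hδ hd) (fun _ => D.relT_zero_smul hδ hd) h

/-- A graded algebra with a finite resolution over its relative enveloping algebra is homologically
smooth. -/
theorem homologicallySmooth_of_relBimodule {n : ℕ}
    (h : (D.relBimodule hδ hd).HasFiniteResolution n) : HomologicallySmooth ℛ := by
  obtain ⟨m, hm⟩ := exists_hasFiniteResolution_restrict (D := D.relReduction hδ hd)
    (envelopingGrading_eq_bot hδ) hd h
  -- `k` inverts the bijection of `R` with its Λ-module version, as a morphism over the full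
  -- enveloping algebra.
  obtain ⟨k, hk⟩ := (D.toRelBimodule hδ hd).hom.exists_factor (D.toRelBimodule_bijective hδ hd).1
    (GradedMod.Hom.id _) (D.toRelBimodule hδ hd).surjective
  replace hk : ∀ y, (D.toRelBimodule hδ hd).π (k.toLinearMap y) = y := hk
  refine (hm.of_bijective k ⟨Function.LeftInverse.injective hk, fun x => ?_⟩).hasBounded
    (GradedAlgebra.iSup_eq_top _)
  exact ⟨(D.toRelBimodule hδ hd).π x, (D.toRelBimodule_bijective hδ hd).1 (hk _)⟩

/-- If a graded algebra has a finite resolution over its relative enveloping algebra, then its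
quotient by `t - 1` is homologically smooth. -/
theorem homologicallySmooth_generic {f : R →ₐ[K] B}
    (γ : G →+ H) (hγ : γ D.d = 0) (hf : Function.Surjective f)
    (hfc : f D.c = algebraMap K B 1) (hfk : ∀ p, f p = 0 → ∃ q, p = (D.c - 1) * q)
    (hfm : ∀ i, ∀ a ∈ ℛ i, f a ∈ ℬ (γ i))
    (hfm' : ∀ h, ∀ b ∈ ℬ h, ∃ i, γ i = h ∧ ∃ a ∈ ℛ i, f a = b) {n : ℕ}
    (h : (D.relBimodule hδ hd).HasFiniteResolution n) : HomologicallySmooth ℬ := by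
  let E := D.genericReduction hδ hd γ hγ hf hfc hfk hfm hfm'
  let r : E.Reduction ((D.relBimodule hδ hd).coarsen γ) (GradedMod.regularBimodule ℬ) :=
    E.reductionOfBijective (D.relEnvelopingMk : R ⊗[K] Rᵐᵒᵖ →+* D.relEnveloping)
      D.relEnvelopingMk_surjective (D.toRelBimodule hδ hd).π (D.toRelBimodule_bijective hδ hd)
      (D.toRelBimodule_smul hδ hd) (bimoduleMap ℛ ℬ f) hf (bimoduleMap_smul f)
      (D.tLeft - algebraMap K _ 1) rfl
      (D.exists_of_bimoduleMap_eq_zero fun p hp => by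
        rw [map_one]
        exact hfk p hp)
      fun g x hx => by
        have key : ((D.relBimodule hδ hd).coarsen γ).piece g ≤
            (((GradedMod.regularBimodule ℬ).piece g).comap (bimoduleMap ℛ ℬ f)).map
              (D.toRelBimodule hδ hd).π := by
          refine iSup_le ?_
          rintro ⟨i, rfl⟩ y hy
          obtain ⟨x, hx, rfl⟩ := (D.toRelBimodule hδ hd).π_mem_iff_exists hy
          exact ⟨x, hfm i _ hx, rfl⟩
        obtain ⟨x', hx', he⟩ := key hx
        rwa [← (D.toRelBimodule_bijective hδ hd).1 he]
  exact (r.hasFiniteResolution (fun _ => D.relT_one_smul hδ hd) (h.coarsen γ)).hasBounded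
    (GradedAlgebra.iSup_eq_top _)

end RegularBimodule

end GradedReduction

/-! ### The Rees algebra and its quotients at `t = 0` and `t = 1`. -/

namespace HomoFiltration

variable {G : Type v} [AddCommGroup G] [DecidableEq G]
  {K : Type w} [Field K] {A : Type u} [Ring A] [Algebra K A]
  {𝒜 : G → Submodule K A} [GradedAlgebra 𝒜] (F : HomoFiltration 𝒜)

theorem reesT_mem : F.reesT ∈ F.reesGrading (1, 0) :=
  ⟨⟨1, F.mono zero_le_one F.one_mem⟩, SetLike.one_mem_graded 𝒜, rfl⟩

/-- `t` is invertible in the Laurent polynomials. -/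
theorem reesT_regular (p : F.rees) (h : F.reesT * p = 0) : p = 0 := by
  refine Subtype.ext ?_
  have h1 : (LaurentPolynomial.T 1 : A[T;T⁻¹]) * p = 0 := congrArg Subtype.val h
  have h2 := congrArg (fun q : A[T;T⁻¹] => LaurentPolynomial.T (-1) * q) h1
  simpa [← mul_assoc, ← LaurentPolynomial.T_add] using h2

theorem exists_of_assocGradedMk_eq_zero (p : F.rees) (h : F.assocGradedMk p = 0) :
    ∃ q, p = F.reesT * q := by
  obtain ⟨q, hq⟩ := Ideal.mem_span_singleton'.1
    ((Ideal.Quotient.eq_zero_iff_mem (I := F.reesIdeal)).1 h)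
  exact ⟨q, by rw [F.reesT_mul_comm, hq]⟩

theorem assocGradedMk_reesT : F.assocGradedMk F.reesT = 0 :=
  Ideal.Quotient.eq_zero_iff_mem.2 (Ideal.subset_span rfl)

theorem assocGradedMk_surjective : Function.Surjective F.assocGradedMk :=
  Ideal.Quotient.mk_surjective

theorem reesGrading_eq_bot (hF : F.IsPositive) {i : ℤ × G} (hi : i.1 < 0) :
    F.reesGrading i = ⊥ := by
  rw [eq_bot_iff]
  intro p hp
  obtain ⟨a, ha, -, h⟩ := F.mem_reesGrading.1 hp
  rw [hF _ hi, Submodule.mem_bot] at ha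
  refine Subtype.ext ?_
  rw [h, ha, AddMonoidAlgebra.single_zero]
  rfl

section Evaluation

/-- The evaluation of the Rees algebra at `t = 1`. -/
noncomputable def reesEval : F.rees →ₐ[K] A :=
  (AddMonoidAlgebra.liftNCAlgHom (AlgHom.id K A) 1 fun _ _ => Commute.one_right _).comp F.rees.val

theorem reesEval_of_coe_eq_single {p : F.rees} {n : ℤ} {a : A}
    (h : (p : A[T;T⁻¹]) = AddMonoidAlgebra.single n a) : F.reesEval p = a := by
  change AddMonoidAlgebra.liftNC _ _ (p : A[T;T⁻¹]) = a
  rw [h, AddMonoidAlgebra.liftNC_single]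
  exact mul_one a

theorem reesEval_surjective : Function.Surjective F.reesEval := by
  intro a
  have ha : a ∈ ⋃ n, (F.F n : Set A) := by rw [F.iUnion_eq]; trivial
  obtain ⟨n, hn⟩ := Set.mem_iUnion.1 ha
  exact ⟨F.reesMonomial n ⟨a, hn⟩, F.reesEval_of_coe_eq_single rfl⟩

theorem reesEval_reesT : F.reesEval F.reesT = 1 := F.reesEval_of_coe_eq_single rfl

theorem reesT_mul_reesMonomial (n : ℤ) (a : A) (ha : a ∈ F.F n) (ha' : a ∈ F.F (n + 1)) :
    F.reesT * F.reesMonomial n ⟨a, ha⟩ = F.reesMonomial (n + 1) ⟨a, ha'⟩ := by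
  refine Subtype.ext ?_
  change AddMonoidAlgebra.single 1 1 * AddMonoidAlgebra.single n a =
    AddMonoidAlgebra.single (n + 1) a
  rw [AddMonoidAlgebra.single_mul_single, one_mul, add_comm]

/-- Telescoping: consecutive monomials with coefficient `a` differ by `(t - 1) * a t ^ m`. -/
theorem reesMonomial_sub_mem {n m : ℤ} (h : n ≤ m) (a : A) (ha : a ∈ F.F n) (ha' : a ∈ F.F m) :
    F.reesMonomial m ⟨a, ha'⟩ - F.reesMonomial n ⟨a, ha⟩ ∈
      LinearMap.range (LinearMap.mulLeft K (F.reesT - 1)) := by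
  induction m, h using Int.leInduction with
  | base => rw [sub_self]; exact zero_mem _
  | succ m h ih =>
    have ha'' := F.mono h ha
    rw [← sub_add_sub_cancel (F.reesMonomial (m + 1) ⟨a, ha'⟩) (F.reesMonomial m ⟨a, ha''⟩)]
    refine add_mem ?_ (ih ha'')
    rw [← F.reesT_mul_reesMonomial m a ha'' ha']
    exact ⟨F.reesMonomial m ⟨a, ha''⟩, by rw [LinearMap.mulLeft_apply, sub_mul, one_mul]⟩

/-- Modulo `t - 1` all homogeneous parts can be raised to a common power of `t` and added there.
Evaluation at `t = 1` recovers the coefficient of the resulting monomial, whence the kernel of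
`reesEval` is generated by `t - 1`. -/
theorem exists_sub_reesMonomial_mem (p : F.rees) : ∃ (n : ℤ) (a : F.F n),
    p - F.reesMonomial n a ∈ LinearMap.range (LinearMap.mulLeft K (F.reesT - 1)) := by
  induction F.mem_iSup_reesGrading p using Submodule.iSup_induction' with
  | zero => exact ⟨0, 0, by rw [map_zero, sub_zero]; exact zero_mem _⟩
  | mem i p hp =>
    obtain ⟨a, -, rfl⟩ := hp
    exact ⟨i.1, a, by rw [sub_self]; exact zero_mem _⟩
  | add p q _ _ hp hq =>
    obtain ⟨n, ⟨a, ha⟩, h⟩ := hp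
    obtain ⟨m, ⟨b, hb⟩, h'⟩ := hq
    have ha' := F.mono (le_max_left n m) ha
    have hb' := F.mono (le_max_right n m) hb
    refine ⟨max n m, ⟨a, ha'⟩ + ⟨b, hb'⟩, ?_⟩
    have h1 := F.reesMonomial_sub_mem (le_max_left n m) a ha ha'
    have h2 := F.reesMonomial_sub_mem (le_max_right n m) b hb hb'
    rw [map_add]
    convert add_mem (sub_mem h h1) (sub_mem h' h2) using 1
    abel

theorem exists_of_reesEval_eq_zero (p : F.rees) (h : F.reesEval p = 0) :
    ∃ q, p = (F.reesT - 1) * q := by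
  obtain ⟨n, ⟨a, ha⟩, q, hq⟩ := F.exists_sub_reesMonomial_mem p
  have h1 := congrArg F.reesEval hq
  rw [LinearMap.mulLeft_apply, map_mul, map_sub, map_sub, h, F.reesEval_reesT, map_one, sub_self,
    zero_mul, zero_sub, eq_comm, neg_eq_zero, F.reesEval_of_coe_eq_single rfl] at h1
  subst h1
  refine ⟨q, ?_⟩
  rw [LinearMap.mulLeft_apply] at hq
  rw [hq]
  exact (sub_eq_self.2 (map_zero (F.reesMonomial n))).symm

end Evaluation

/-- The associated graded algebra as the quotient of the Rees algebra by `t`. -/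
noncomputable def assocReduction : GradedReduction F.reesGrading F.assocGrading where
  φ := F.assocGradedMk
  surjective := F.assocGradedMk_surjective
  c := F.reesT
  d := (1, 0)
  c_mem := F.reesT_mem
  comm := F.reesT_mul_comm
  regular := F.reesT_regular
  φ_c := F.assocGradedMk_reesT
  exists_of_φ_eq_zero := F.exists_of_assocGradedMk_eq_zero
  map_eq _ := rfl

end HomoFiltration

theorem mainTheorem7 {G : Type v} [AddCommGroup G] [DecidableEq G] {K : Type w} [Field K]
    {A : Type u} [Ring A] [Algebra K A] (𝒜 : G → Submodule K A) [GradedAlgebra 𝒜]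
    (F : HomoFiltration 𝒜) (hF : F.IsPositive)
    (hG : HomologicallySmooth (G := ℤ × G) F.assocGrading) :
    HomologicallySmooth (G := ℤ × G) F.reesGrading ∧ HomologicallySmooth 𝒜 := by
  obtain ⟨n, hn⟩ := GradedMod.HasBoundedFGProjectiveResolution.exists_hasFiniteResolution hG
  -- Positivity of the filtration enters here: the ℤ-component of the degree is the `δ` that drives
  -- the nilpotence and Nakayama arguments.
  have hδ : ∀ i : ℤ × G, AddMonoidHom.fst ℤ G i < 0 → F.reesGrading i = ⊥ :=
    fun i hi => F.reesGrading_eq_bot hF hi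
  have hd : 0 < AddMonoidHom.fst ℤ G F.assocReduction.d := zero_lt_one
  have h := F.assocReduction.hasFiniteResolution_relBimodule hδ hd hn
  refine ⟨F.assocReduction.homologicallySmooth_of_relBimodule hδ hd h,
    F.assocReduction.homologicallySmooth_generic hδ hd (AddMonoidHom.snd ℤ G) rfl
      F.reesEval_surjective (F.reesEval_reesT.trans (map_one _).symm) F.exists_of_reesEval_eq_zero
      (fun i p hp => ?_) (fun g a ha => ?_) h⟩
  · obtain ⟨a, -, ha, h⟩ := F.mem_reesGrading.1 hp
    rw [F.reesEval_of_coe_eq_single h]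
    exact ha
  · obtain ⟨n, hn⟩ := Set.mem_iUnion.1 (F.iUnion_eq.ge (Set.mem_univ a))
    exact ⟨(n, g), rfl, F.reesMonomial n ⟨a, hn⟩, ⟨⟨a, hn⟩, ha, rfl⟩,
      F.reesEval_of_coe_eq_single rfl⟩
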